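/- Setting. Let $F=\frac1N\sum_{i=1}^N f_i$ on $\mathbb R^d$ (Euclidean norm; spectral norm for matrices) be bounded below, each $f_i$ twice differentiable, with $f_i$, $\nabla f_i$, $\nabla^2 f_i$ Lipschitz with constants $L_0,L_1,L_2$. Let $m\ge 1$ be an integer and $M,\epsilon_1>0$. The algorithm SVRC under sampling without replacement starts from $x_0\in\mathbb R^d$; in iteration $k=0,1,\dots$, with $\tilde x=x_{\lfloor k/m\rfloor m}$: if $k \bmod m=0$, it sets $g_k=\nabla F(x_k)$, $H_k=\nabla^2F(x_k)$; otherwise it draws nonempty index sets $\xi_g(k)$, $\xi_H(k)\subseteq\{1,\dots,N\}$, where the sizes $|\xi_g(k)|,|\xi_H(k)|$ are determined by the past and, conditionally on the past, each set is uniformly distributed over all subsets of $\{1,\dots,N\}$ of its size, and it sets $$g_k=\tfrac{1}{|\xi_g(k)|}\sum_{i\in\xi_g(k)}\big(\nabla f_i(x_k)-\nabla f_i(\tilde x)\big)+\nabla F(\tilde x),\qquad H_k=\tfrac{1}{|\xi_H(k)|}\sum_{i\in\xi_H(k)}\big(\nabla^2 f_i(x_k)-\nabla^2 f_i(\tilde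 x)\big)+\nabla^2F(\tilde x).$$ Then $s_{k+1}\in\arg\min_{s}\; g_k^\top s+\frac12 s^\top H_ks+\frac M6\|s\|^3$, $x_{k+1}=x_k+s_{k+1}$, and the algorithm returns $x_{k+1}$ if $\max\{\|s_{k+1}\|,\|s_k\|\}\le\epsilon_1$ ($s_0$ is arbitrary). Let $\alpha,\beta>0$ and $0<\zeta<1$. Theorem. Let $k\ge0$, and let $A$ be an event of positive probability that is determined by the information available before the index sets of iteration $k$ are drawn, such that iteration $k$ is carried out (the algorithm has not returned before) on $A$; for example, the event that iteration $k$ is carried out. (i) If, almost surely on $A$, $$|\xi_g(k)|\ \ge\ \left(\frac1N+\frac{\beta^2\max\{\|s_k\|^4,\epsilon_1^4\}}{64L_1^2\|x_k-\tilde x\|^2\log(2(d+1)/\zeta)}\right)^{-1},$$ then $\|g_k-\nabla F(x_k)\|\le\beta\max\{\|s_k\|^2,\epsilon_1^2\}$ holds with conditional probability at least $1-\zeta$ given $A$. (ii) If, almost surely on $A$, $$|\xi_H(k)|\ \ge\ \left(\frac1N+\frac{\alpha^2\max\{\|s_k\|^2,\epsilon_1^2\}}{64L_2^2\|x_k-\tilde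 x\|^2\log(4d/\zeta)}\right)^{-1},$$ then $\|H_k-\nabla^2F(x_k)\|\le\alpha\max\{\|s_k\|,\epsilon_1\}$ holds with conditional probability at least $1-\zeta$ given $A$. Where $L_1\|x_k-\tilde x\|=0$ (in (i)) or $L_2\|x_k-\tilde x\|=0$ (in (ii)), the right-hand side of the size condition is read as $0$. In iterations with $k\bmod m=0$ the size condition is void. -/

import Mathlib

open MeasureTheory ProbabilityTheory
open scoped NNReal Gradient RealInnerProductSpace

namespace SVRC

/-- The space `ℝ^d` with its Euclidean norm. -/
abbrev E (d : ℕ) := EuclideanSpace ℝ (Fin d)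

/-- The finite-sum objective `F = (1/N) ∑ f_i`. -/
noncomputable def objective {d N : ℕ} (f : Fin N → E d → ℝ) (x : E d) : ℝ :=
  (1 / (N : ℝ)) * ∑ i, f i x

/-- The Hessian of `g` at `x` as a linear operator; its norm is the spectral norm. -/
noncomputable def hessian {d : ℕ} (g : E d → ℝ) (x : E d) : E d →L[ℝ] E d :=
  fderiv ℝ (∇ g) x

/-- The standing assumption on the objective: `F` is bounded below; every `f_i` is twice
differentiable, and `f_i`, its gradient and its Hessian are Lipschitz with constants
`L₀`, `L₁`, `L₂`. -/
structure ObjectiveAssumption {d N : ℕ} (f : Fin N → E d → ℝ) (L₀ L₁ L₂ : ℝ≥0) : Prop where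
  bddBelow : BddBelow (Set.range (objective f))
  differentiable : ∀ i, Differentiable ℝ (f i)
  differentiable_gradient : ∀ i, Differentiable ℝ (∇ (f i))
  lipschitz : ∀ i, LipschitzWith L₀ (f i)
  lipschitz_gradient : ∀ i, LipschitzWith L₁ (∇ (f i))
  lipschitz_hessian : ∀ i, LipschitzWith L₂ (hessian (f i))

section Runs

variable {Ω : Type*} {d N : ℕ}

/-- The initial point `x̃` of the inner loop (of length `m`) that contains iteration `k`. -/
def snapshot (m : ℕ) (x : ℕ → Ω → E d) (k : ℕ) (ω : Ω) : E d :=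
  x (k / m * m) ω

/-- The variance-reduced gradient estimate `g_k`, with minibatch `ξ k ω`. -/
noncomputable def gradEstimate (f : Fin N → E d → ℝ) (m : ℕ) (x : ℕ → Ω → E d)
    (ξ : ℕ → Ω → Finset (Fin N)) (k : ℕ) (ω : Ω) : E d :=
  if k % m = 0 then ∇ (objective f) (x k ω)
  else (1 / ((ξ k ω).card : ℝ)) •
      ∑ i ∈ ξ k ω, (∇ (f i) (x k ω) - ∇ (f i) (snapshot m x k ω))
    + ∇ (objective f) (snapshot m x k ω)

/-- The variance-reduced Hessian estimate `H_k`, with minibatch `ξ k ω`. -/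
noncomputable def hessEstimate (f : Fin N → E d → ℝ) (m : ℕ) (x : ℕ → Ω → E d)
    (ξ : ℕ → Ω → Finset (Fin N)) (k : ℕ) (ω : Ω) : E d →L[ℝ] E d :=
  if k % m = 0 then hessian (objective f) (x k ω)
  else (1 / ((ξ k ω).card : ℝ)) •
      ∑ i ∈ ξ k ω, (hessian (f i) (x k ω) - hessian (f i) (snapshot m x k ω))
    + hessian (objective f) (snapshot m x k ω)

/-- The cubic-regularized model `⟨g, u⟩ + ⟨u, H u⟩ / 2 + (M / 6) ‖u‖³`. -/
noncomputable def cubicModel (M : ℝ) (g : E d) (H : E d →L[ℝ] E d) (u : E d) : ℝ :=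
  ⟪g, u⟫ + 1 / 2 * ⟪u, H u⟫ + M / 6 * ‖u‖ ^ 3

/-- Iteration `k` is carried out: the algorithm has not returned in an iteration `j < k`, that is,
the stopping test `max {‖s_{j+1}‖, ‖s_j‖} ≤ ε₁` has failed for all `j < k`. -/
def Running (ε₁ : ℝ) (s : ℕ → Ω → E d) (k : ℕ) (ω : Ω) : Prop :=
  ∀ j < k, ¬ max ‖s (j + 1) ω‖ ‖s j ω‖ ≤ ε₁

/-- Sampling without replacement: on the event `R`, the random set `ξ` is nonempty, its size is
determined by `𝓖` (the past), and given `𝓖` it is uniformly distributed over the subsets of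
the index set that have this size. -/
structure UniformWithoutReplacement [MeasurableSpace Ω] (μ : Measure Ω) (𝓖 : MeasurableSpace Ω)
    (R : Set Ω) (ξ : Ω → Finset (Fin N)) : Prop where
  nonempty : ∀ ω ∈ R, (ξ ω).Nonempty
  size_known : ∀ n : ℕ, MeasurableSet[𝓖] (R ∩ {ω | (ξ ω).card = n})
  uniform : ∀ (n : ℕ) (A : Set Ω), MeasurableSet[𝓖] A → A ⊆ R ∩ {ω | (ξ ω).card = n} →
    ∀ T : Finset (Fin N), T.card = n → μ (A ∩ {ω | ξ ω = T}) = μ A / (N.choose n : ENNReal)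

/-- A run of the algorithm SVRC under sampling without replacement, with inner loops of length `m`,
cubic penalty `M`, tolerance `ε₁` and starting point `x₀`. The σ-algebra `ℱ k` is the information
available before the minibatches `ξg k` and `ξH k` are drawn. The vector `s 0`, which the algorithm
reads in its first stopping test but does not compute, is arbitrary, and so are
the iterates after the algorithm has returned. -/
structure IsRun [mΩ : MeasurableSpace Ω] (f : Fin N → E d → ℝ) (m : ℕ) (M ε₁ : ℝ) (x₀ : E d)
    (μ : Measure Ω) (ℱ : Filtration ℕ mΩ) (x s : ℕ → Ω → E d)
    (ξg ξH : ℕ → Ω → Finset (Fin N)) : Prop where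
  init : ∀ ω, x 0 ω = x₀
  measurable_x : ∀ k, Measurable[ℱ k] (x k)
  measurable_s : ∀ k, Measurable[ℱ k] (s k)
  measurable_grad_batch : ∀ k T, MeasurableSet[ℱ (k + 1)] {ω | ξg k ω = T}
  measurable_hess_batch : ∀ k T, MeasurableSet[ℱ (k + 1)] {ω | ξH k ω = T}
  sample_grad : ∀ k, k % m ≠ 0 →
    UniformWithoutReplacement μ (ℱ k) {ω | Running ε₁ s k ω} (ξg k)
  sample_hess : ∀ k, k % m ≠ 0 →
    UniformWithoutReplacement μ (ℱ k) {ω | Running ε₁ s k ω} (ξH k)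
  step_min : ∀ k ω, Running ε₁ s k ω →
    IsMinOn (cubicModel M (gradEstimate f m x ξg k ω) (hessEstimate f m x ξH k ω)) Set.univ
      (s (k + 1) ω)
  step_update : ∀ k ω, Running ε₁ s k ω → x (k + 1) ω = x k ω + s (k + 1) ω

end Runs

end SVRC

/-! Given the past, the error of either estimate is the mean of a uniform sample minus the mean of
the whole population `a i = h i (x k) - h i x̃`, where `h i` is the gradient or the Hessian of `f
i`. This population is fixed by the past and bounded by `r = L ‖x k - x̃‖`, so a tail bound for
sampling without replacement from a bounded finite population suffices.

Let the sample have size `n ≤ N / 2`. In a uniformly random ordering of the population, take the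
first `n` and the next `n` members as two disjoint samples. With the first sample fixed, the mean of
the difference of the two sample sums is `N / (N - n) ≥ 1` times the centred first sum. By Jensen,
the `cosh` moment of the deviation is at most that of the difference (`sum_cosh_norm_sampleDev_le`).
Exchanging paired members preserves the uniform law and flips the signs of their differences, so the
difference may be replaced by a Rademacher sum of `n` terms of norm at most `2 r`.

Such sums satisfy `E cosh (θ ‖X‖) ≤ K exp (n (2 r θ)²)`. For vectors `K = 1`, by a two-point
inequality in inner product spaces (`cosh_norm_add_add_cosh_norm_sub_le`). For self-adjoint
operators `K = d`, by the noncommutative Khintchine inequality for trace moments.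

A Chernoff bound then gives the tail. A sample larger than half the population is replaced by its
complement, whose deviation has the same norm; this yields the finite-population term `1 / N` in the
size condition (`card_lt_norm_sampleMean_sub_mean_le`). Finally,
`UniformWithoutReplacement.measure_inter_bad_le` integrates the proportion of bad samples over the
event `A`. -/

namespace SVRC

/-! ### Rademacher sums in an inner product space -/

/-- The sign `±1` encoded by a Boolean. -/
def boolSign (b : Bool) : ℝ := if b then 1 else -1

lemma boolSign_not (b : Bool) : boolSign (!b) = -boolSign b := by
  cases b <;> simp [boolSign]

lemma boolSign_mul_self (b : Bool) : boolSign b * boolSign b = 1 := by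
  cases b <;> simp [boolSign]

/-- The Rademacher sum with signs `ε`. -/
noncomputable def rademacherSum {W : Type*} [AddCommGroup W] [Module ℝ W] {n : ℕ} (D : Fin n → W)
    (ε : Fin n → Bool) : W :=
  ∑ l, boolSign (ε l) • D l

/-- Convexity of the power function: with a fixed sum, spreading two points apart increases the sum
of their powers. It compares the even Taylor coefficients of `cosh` below. -/
lemma pow_add_pow_le_of_add_eq {s t u v : ℝ} (hs : 0 ≤ s) (hsu : s ≤ u) (hsv : s ≤ v)
    (h : u + v = s + t) (k : ℕ) : u ^ k + v ^ k ≤ s ^ k + t ^ k := by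
  have hut : u ≤ t := by linarith
  rcases (hsu.trans hut).eq_or_lt with hst | hst
  · have hu : u = s := by linarith
    have hv : v = s := by linarith
    rw [hu, hv, ← hst]
  · have hpos : 0 < t - s := sub_pos.2 hst
    have hc := convexOn_pow (𝕜 := ℝ) k
    -- On `[s, t]` the power lies below its chord; the chord values at `u` and `v` add up to those
    -- at `s` and `t`.
    have key : ∀ w, s ≤ w → w ≤ t →
        w ^ k ≤ (t - w) / (t - s) * s ^ k + (w - s) / (t - s) * t ^ k := by
      intro w hsw hwt
      have := hc.2 (Set.mem_Ici.2 hs) (Set.mem_Ici.2 (hs.trans hst.le))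
        (div_nonneg (sub_nonneg.2 hwt) hpos.le) (div_nonneg (sub_nonneg.2 hsw) hpos.le)
        (by rw [← add_div, div_eq_one_iff_eq hpos.ne']; ring)
      simp only [smul_eq_mul] at this
      have hw : (t - w) / (t - s) * s + (w - s) / (t - s) * t = w := by
        field_simp
        ring
      rwa [hw] at this
    have h1 := key u hsu hut
    have h2 := key v hsv (by linarith)
    have hv : v = s + t - u := by linarith
    have h3 : (t - u) / (t - s) * s ^ k + (u - s) / (t - s) * t ^ k +
        ((t - v) / (t - s) * s ^ k + (v - s) / (t - s) * t ^ k) = s ^ k + t ^ k := by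
      rw [hv]
      field_simp
      ring
    linarith

section Vector

variable {V : Type*} [NormedAddCommGroup V] [InnerProductSpace ℝ V]

/-- The squares `‖x ± y‖ ^ 2` have the same sum as `(‖x‖ ± ‖y‖) ^ 2` by the parallelogram law and
lie between them by Cauchy–Schwarz. The Taylor series of `cosh` in even powers are therefore
comparable term by term. -/
lemma cosh_norm_add_add_cosh_norm_sub_le (x y : V) :
    Real.cosh ‖x + y‖ + Real.cosh ‖x - y‖ ≤ 2 * (Real.cosh ‖x‖ * Real.cosh ‖y‖) := by
  have hprod : 2 * (Real.cosh ‖x‖ * Real.cosh ‖y‖) =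
      Real.cosh (‖x‖ - ‖y‖) + Real.cosh (‖x‖ + ‖y‖) := by
    rw [Real.cosh_add, Real.cosh_sub]; ring
  rw [hprod]
  refine hasSum_le (fun k => ?_) ((Real.hasSum_cosh _).add (Real.hasSum_cosh _))
    ((Real.hasSum_cosh _).add (Real.hasSum_cosh _))
  simp only [pow_mul]
  rw [← add_div, ← add_div]
  refine div_le_div_of_nonneg_right ?_ (by positivity)
  have hp := norm_add_sq_real x y
  have hm := norm_sub_sq_real x y
  have hi := abs_le.1 (abs_real_inner_le_norm x y)
  refine pow_add_pow_le_of_add_eq (sq_nonneg _) ?_ ?_ ?_ k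
  · rw [hp]; nlinarith
  · rw [hm]; nlinarith
  · rw [hp, hm]; ring

/-- The offset `x` makes the induction work: it absorbs the first signed vector. -/
lemma sum_cosh_norm_add_rademacher_le {n : ℕ} (w : Fin n → V) (x : V) :
    ∑ ε : Fin n → Bool, Real.cosh ‖x + ∑ l, boolSign (ε l) • w l‖ ≤
      2 ^ n * (Real.cosh ‖x‖ * ∏ l, Real.cosh ‖w l‖) := by
  induction n generalizing x with
  | zero => simp
  | succ n ih =>
    rw [← (Fin.consEquiv (fun _ : Fin (n + 1) => Bool)).sum_comp, Fintype.sum_prod_type]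
    simp only [Fin.consEquiv_apply, Fin.sum_univ_succ, Fin.cons_zero, Fin.cons_succ,
      Fintype.sum_bool, Fin.prod_univ_succ, ← add_assoc]
    have h1 := ih (fun l => w l.succ) (x + boolSign true • w 0)
    have h2 := ih (fun l => w l.succ) (x + boolSign false • w 0)
    have h3 := cosh_norm_add_add_cosh_norm_sub_le x (w 0)
    have hP : 0 ≤ ∏ l : Fin n, Real.cosh ‖w l.succ‖ :=
      Finset.prod_nonneg fun _ _ => (Real.cosh_pos _).le
    refine (add_le_add h1 h2).trans ?_
    have e1 : x + boolSign true • w 0 = x + w 0 := by simp [boolSign]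
    have e2 : x + boolSign false • w 0 = x - w 0 := by simp [boolSign, sub_eq_add_neg]
    rw [e1, e2]
    calc _ = 2 ^ n * (∏ l : Fin n, Real.cosh ‖w l.succ‖) *
          (Real.cosh ‖x + w 0‖ + Real.cosh ‖x - w 0‖) := by ring
      _ ≤ 2 ^ n * (∏ l : Fin n, Real.cosh ‖w l.succ‖) *
          (2 * (Real.cosh ‖x‖ * Real.cosh ‖w 0‖)) := by gcongr
      _ = _ := by ring

/-- A Rademacher sum of vectors of norm at most `b` has a sub-Gaussian norm. -/
theorem sum_cosh_norm_rademacher_le {n : ℕ} (w : Fin n → V) {b : ℝ} (hw : ∀ l, ‖w l‖ ≤ b)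
    (θ : ℝ) :
    ∑ ε : Fin n → Bool, Real.cosh (θ * ‖rademacherSum w ε‖) ≤
      2 ^ n * (1 * Real.exp (n * (θ * b) ^ 2)) := by
  have h := sum_cosh_norm_add_rademacher_le (fun l => θ • w l) 0
  have hl : ∀ ε : Fin n → Bool,
      Real.cosh ‖(0 : V) + ∑ l, boolSign (ε l) • θ • w l‖ =
        Real.cosh (θ * ‖rademacherSum w ε‖) := by
    intro ε
    rw [zero_add, rademacherSum]
    simp_rw [smul_comm _ θ]
    rw [← Finset.smul_sum, norm_smul, ← Real.cosh_abs (θ * _), abs_mul, abs_norm, Real.norm_eq_abs]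
  simp only [hl, norm_zero, Real.cosh_zero] at h
  refine h.trans ?_
  gcongr
  calc ∏ l, Real.cosh ‖θ • w l‖ ≤ ∏ _l : Fin n, Real.exp ((θ * b) ^ 2) := by
        refine Finset.prod_le_prod (fun _ _ => (Real.cosh_pos _).le) fun l _ => ?_
        -- A factor `1 / 2` in the exponent is given up, to match the form of the operator bound.
        refine (Real.cosh_le_exp_half_sq _).trans (Real.exp_le_exp.2 ?_)
        rw [norm_smul, mul_pow, mul_pow, Real.norm_eq_abs, sq_abs]
        have : ‖w l‖ ^ 2 ≤ b ^ 2 := pow_le_pow_left₀ (norm_nonneg _) (hw l) 2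
        nlinarith [sq_nonneg θ, sq_nonneg b, mul_le_mul_of_nonneg_left this (sq_nonneg θ),
          mul_nonneg (sq_nonneg θ) (sq_nonneg ‖w l‖)]
    _ = Real.exp (n * (θ * b) ^ 2) := by
        rw [Finset.prod_const, ← Real.exp_nat_mul]; simp

end Vector

/-! ### Rademacher sums of self-adjoint operators -/

section Operator

variable {V : Type*} [NormedAddCommGroup V] [InnerProductSpace ℝ V]

/-- The trace of a continuous linear endomorphism. -/
noncomputable def opTrace (A : V →L[ℝ] V) : ℝ := LinearMap.trace ℝ V A

lemma opTrace_eq_sum {ι : Type*} [Fintype ι] (b : OrthonormalBasis ι ℝ V) (A : V →L[ℝ] V) :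
    opTrace A = ∑ i, ⟪b i, A (b i)⟫ :=
  LinearMap.trace_eq_sum_inner _ b

lemma opTrace_add (A B : V →L[ℝ] V) : opTrace (A + B) = opTrace A + opTrace B := by
  simp [opTrace]

lemma opTrace_smul (c : ℝ) (A : V →L[ℝ] V) : opTrace (c • A) = c * opTrace A := by
  simp [opTrace]

lemma opTrace_sum {ι : Type*} (s : Finset ι) (A : ι → V →L[ℝ] V) :
    opTrace (∑ i ∈ s, A i) = ∑ i ∈ s, opTrace (A i) := by
  simp [opTrace]

lemma opTrace_one [FiniteDimensional ℝ V] : opTrace (1 : V →L[ℝ] V) = Module.finrank ℝ V :=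
  LinearMap.trace_one ℝ V

lemma opTrace_pow_of_eigenbasis {ι : Type*} [Fintype ι] {A : V →L[ℝ] V}
    (b : OrthonormalBasis ι ℝ V) (c : ι → ℝ) (q : ℕ) (h : ∀ i, (A ^ q) (b i) = c i ^ q • b i) :
    opTrace (A ^ q) = ∑ i, c i ^ q := by
  rw [opTrace_eq_sum b]
  refine Finset.sum_congr rfl fun i _ => ?_
  rw [h, real_inner_smul_right, real_inner_self_eq_norm_sq, b.norm_eq_one]
  simp

variable [CompleteSpace V]

lemma inner_apply_comm_of_isSelfAdjoint {A : V →L[ℝ] V} (hA : IsSelfAdjoint A) (x y : V) :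
    ⟪A x, y⟫ = ⟪x, A y⟫ :=
  ContinuousLinearMap.isSelfAdjoint_iff_isSymmetric.1 hA x y

lemma isSelfAdjoint_rademacherSum {n : ℕ} {D : Fin n → V →L[ℝ] V}
    (hD : ∀ l, IsSelfAdjoint (D l)) (ε : Fin n → Bool) : IsSelfAdjoint (rademacherSum D ε) := by
  rw [rademacherSum]
  exact isSelfAdjoint_sum _ fun l _ => (IsSelfAdjoint.all (boolSign (ε l))).smul (hD l)

variable [FiniteDimensional ℝ V]

/-- The spectral theorem, for powers. -/
lemma exists_eigenbasis_pow {A : V →L[ℝ] V} (hA : IsSelfAdjoint A) :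
    ∃ (b : OrthonormalBasis (Fin (Module.finrank ℝ V)) ℝ V) (c : Fin (Module.finrank ℝ V) → ℝ),
      ∀ (q : ℕ) (i), (A ^ q) (b i) = c i ^ q • b i := by
  have hS := ContinuousLinearMap.isSelfAdjoint_iff_isSymmetric.1 hA
  refine ⟨hS.eigenvectorBasis rfl, hS.eigenvalues rfl, fun q i => ?_⟩
  induction q with
  | zero => simp
  | succ q ih =>
    have h1 : A (hS.eigenvectorBasis rfl i) =
        hS.eigenvalues rfl i • hS.eigenvectorBasis rfl i := hS.apply_eigenvectorBasis rfl i
    rw [pow_succ, mul_apply_eq_comp, h1, map_smul, ih, smul_smul, pow_succ, mul_comm]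

lemma pow_mul_pow_le_add_pow {p q r : ℕ} (hr : q + p = 2 * r) (x y : ℝ) :
    x ^ q * y ^ p ≤ x ^ (2 * r) + y ^ (2 * r) := by
  have hx : 0 ≤ |x| := abs_nonneg x
  have hy : 0 ≤ |y| := abs_nonneg y
  have h1 : x ^ q * y ^ p ≤ |x| ^ q * |y| ^ p := by
    rw [← abs_pow, ← abs_pow, ← abs_mul]; exact le_abs_self _
  have ex : x ^ (2 * r) = |x| ^ (2 * r) := by rw [pow_mul, pow_mul, sq_abs]
  have ey : y ^ (2 * r) = |y| ^ (2 * r) := by rw [pow_mul, pow_mul, sq_abs]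
  rw [ex, ey]
  refine h1.trans ?_
  rcases le_total |x| |y| with h | h
  · have : |x| ^ q * |y| ^ p ≤ |y| ^ q * |y| ^ p := by gcongr
    rw [← pow_add, hr] at this
    linarith [pow_nonneg hx (2 * r)]
  · have : |x| ^ q * |y| ^ p ≤ |x| ^ q * |x| ^ p := by gcongr
    rw [← pow_add, hr] at this
    linarith [pow_nonneg hy (2 * r)]

/-- In eigenbases of `A` and `B` the trace is a sum of `c i ^ q * e j ^ p` weighted by squared
matrix entries of `D`. The monomial is split into even powers, and each row or column of squared
entries sums to at most `‖D‖ ^ 2`. -/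
lemma opTrace_pow_mul_mul_pow_mul_le {A B D : V →L[ℝ] V} (hA : IsSelfAdjoint A)
    (hB : IsSelfAdjoint B) (hD : IsSelfAdjoint D) {p q r : ℕ} (hr : q + p = 2 * r) :
    opTrace (A ^ q * D * B ^ p * D) ≤
      ‖D‖ ^ 2 * (opTrace (A ^ (2 * r)) + opTrace (B ^ (2 * r))) := by
  obtain ⟨u, c, hu⟩ := exists_eigenbasis_pow hA
  obtain ⟨w, e, hw⟩ := exists_eigenbasis_pow hB
  rw [opTrace_pow_of_eigenbasis u c _ (hu _), opTrace_pow_of_eigenbasis w e _ (hw _),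
    opTrace_eq_sum u]
  have expand : ∀ i, ⟪u i, (A ^ q * D * B ^ p * D) (u i)⟫ =
      ∑ j, c i ^ q * e j ^ p * ‖⟪w j, D (u i)⟫‖ ^ 2 := by
    intro i
    have h1 : ⟪u i, (A ^ q * D * B ^ p * D) (u i)⟫ = c i ^ q * ⟪D (u i), (B ^ p) (D (u i))⟫ := by
      simp only [mul_apply_eq_comp]
      rw [← inner_apply_comm_of_isSelfAdjoint (hA.pow q), hu, real_inner_smul_left,
        inner_apply_comm_of_isSelfAdjoint hD]
    rw [h1, ← w.sum_inner_mul_inner, Finset.mul_sum]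
    refine Finset.sum_congr rfl fun j _ => ?_
    rw [← inner_apply_comm_of_isSelfAdjoint (hB.pow p) (w j), hw, real_inner_smul_left,
      real_inner_comm (w j) (D (u i)), Real.norm_eq_abs, sq_abs]
    ring
  have hDu : ∀ i, ∑ j, ‖⟪w j, D (u i)⟫‖ ^ 2 ≤ ‖D‖ ^ 2 := by
    intro i
    rw [w.sum_sq_norm_inner_right]
    have := D.le_opNorm (u i)
    rw [u.norm_eq_one, mul_one] at this
    gcongr
  have hDw : ∀ j, ∑ i, ‖⟪w j, D (u i)⟫‖ ^ 2 ≤ ‖D‖ ^ 2 := by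
    intro j
    have h1 : ∀ i, ‖⟪w j, D (u i)⟫‖ = ‖⟪u i, D (w j)⟫‖ := by
      intro i
      rw [← inner_apply_comm_of_isSelfAdjoint hD, real_inner_comm]
    simp only [h1]
    rw [u.sum_sq_norm_inner_right]
    have := D.le_opNorm (w j)
    rw [w.norm_eq_one, mul_one] at this
    gcongr
  have hnn : ∀ (t : ℝ), 0 ≤ t ^ (2 * r) := fun t => by rw [pow_mul]; positivity
  calc ∑ i, ⟪u i, (A ^ q * D * B ^ p * D) (u i)⟫
      = ∑ i, ∑ j, c i ^ q * e j ^ p * ‖⟪w j, D (u i)⟫‖ ^ 2 :=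
        Finset.sum_congr rfl fun i _ => expand i
    _ ≤ ∑ i, ∑ j, (c i ^ (2 * r) * ‖⟪w j, D (u i)⟫‖ ^ 2
          + e j ^ (2 * r) * ‖⟪w j, D (u i)⟫‖ ^ 2) := by
        gcongr with i _ j _
        rw [← add_mul]
        gcongr
        exact pow_mul_pow_le_add_pow hr _ _
    _ = ∑ i, c i ^ (2 * r) * ∑ j, ‖⟪w j, D (u i)⟫‖ ^ 2
          + ∑ j, e j ^ (2 * r) * ∑ i, ‖⟪w j, D (u i)⟫‖ ^ 2 := by
        simp only [Finset.sum_add_distrib, Finset.mul_sum]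
        congr 1
        exact Finset.sum_comm
    _ ≤ ∑ i, c i ^ (2 * r) * ‖D‖ ^ 2 + ∑ j, e j ^ (2 * r) * ‖D‖ ^ 2 := by
        gcongr with i _ j _
        · exact hnn _
        · exact hDu i
        · exact hnn _
        · exact hDw j
    _ = _ := by rw [← Finset.sum_mul, ← Finset.sum_mul]; ring

/-- The norm is at most the largest absolute eigenvalue, whose even power is one of the nonnegative
terms of the trace. Nontriviality of `V` ensures that an eigenvalue exists. -/
lemma norm_pow_even_le_opTrace [Nontrivial V] {A : V →L[ℝ] V} (hA : IsSelfAdjoint A) (p : ℕ) :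
    ‖A‖ ^ (2 * p) ≤ opTrace (A ^ (2 * p)) := by
  obtain ⟨u, c, hu⟩ := exists_eigenbasis_pow hA
  rw [opTrace_pow_of_eigenbasis u c _ (hu _)]
  have : Nonempty (Fin (Module.finrank ℝ V)) := ⟨⟨0, Module.finrank_pos⟩⟩
  obtain ⟨i, hi⟩ := Finite.exists_max fun i => |c i|
  have hn : ‖A‖ ≤ |c i| := by
    refine A.opNorm_le_bound (abs_nonneg _) fun x => ?_
    refine le_of_sq_le_sq ?_ (by positivity)
    rw [mul_pow, ← u.sum_sq_norm_inner_right, ← u.sum_sq_norm_inner_right, Finset.mul_sum]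
    refine Finset.sum_le_sum fun j _ => ?_
    have h1 := hu 1 j
    rw [pow_one, pow_one] at h1
    rw [← inner_apply_comm_of_isSelfAdjoint hA, h1, real_inner_smul_left, norm_mul, mul_pow,
      Real.norm_eq_abs]
    have := hi j
    gcongr
  calc ‖A‖ ^ (2 * p) ≤ |c i| ^ (2 * p) := by gcongr
    _ = c i ^ (2 * p) := by rw [pow_mul, pow_mul, sq_abs]
    _ ≤ _ := Finset.single_le_sum (f := fun i => c i ^ (2 * p))
        (fun j _ => by rw [pow_mul]; positivity) (Finset.mem_univ i)

lemma pow_sub_pow_eq_sum {R : Type*} [Ring R] (x y : R) (n : ℕ) :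
    x ^ n - y ^ n = ∑ q ∈ Finset.range n, x ^ q * (x - y) * y ^ (n - 1 - q) := by
  induction n with
  | zero => simp
  | succ n ih =>
    rw [Finset.sum_range_succ]
    have h : ∀ q ∈ Finset.range n,
        x ^ q * (x - y) * y ^ (n + 1 - 1 - q) = x ^ q * (x - y) * y ^ (n - 1 - q) * y := by
      intro q hq
      have : n + 1 - 1 - q = n - 1 - q + 1 := by have := Finset.mem_range.1 hq; omega
      rw [this, pow_succ, ← mul_assoc]
    rw [Finset.sum_congr rfl h, ← Finset.sum_mul, ← ih]
    simp only [Nat.add_sub_cancel, Nat.sub_self, pow_zero, pow_succ, mul_one]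
    noncomm_ring

/-- Flipping one sign. -/
def flipSign {n : ℕ} (l : Fin n) : Equiv.Perm (Fin n → Bool) :=
  Function.Involutive.toPerm (fun ε => Function.update ε l (!ε l)) fun ε => by simp

lemma flipSign_apply {n : ℕ} (l : Fin n) (ε : Fin n → Bool) :
    flipSign l ε = Function.update ε l (!ε l) := rfl

lemma flipSign_apply_self {n : ℕ} (l : Fin n) (ε : Fin n → Bool) : flipSign l ε l = !ε l := by
  simp [flipSign_apply]

lemma rademacherSum_sub_flipSign {W : Type*} [AddCommGroup W] [Module ℝ W] {n : ℕ} (D : Fin n → W)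
    (ε : Fin n → Bool) (l : Fin n) :
    rademacherSum D ε - rademacherSum D (flipSign l ε) = (2 * boolSign (ε l)) • D l := by
  rw [rademacherSum, rademacherSum, ← Finset.sum_sub_distrib, Finset.sum_eq_single l]
  · rw [flipSign_apply_self, boolSign_not, neg_smul, sub_neg_eq_add, ← add_smul, two_mul]
  · intro j _ hj
    simp [flipSign_apply, Function.update_of_ne hj]
  · simp

/-- Noncommutative Khintchine inequality, one step. -/
lemma sum_opTrace_rademacherSum_pow_succ_le {n : ℕ} {D : Fin n → V →L[ℝ] V}
    (hD : ∀ l, IsSelfAdjoint (D l)) (p : ℕ) :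
    ∑ ε, opTrace (rademacherSum D ε ^ (2 * (p + 1))) ≤
      2 * (2 * p + 1) * (∑ l, ‖D l‖ ^ 2) * ∑ ε, opTrace (rademacherSum D ε ^ (2 * p)) := by
  have hX := isSelfAdjoint_rademacherSum hD
  set X := rademacherSum D with hXdef
  have h1 : ∀ ε, opTrace (X ε ^ (2 * (p + 1))) =
      ∑ l, boolSign (ε l) * opTrace (X ε ^ (2 * p + 1) * D l) := by
    intro ε
    have : X ε ^ (2 * (p + 1)) = ∑ l, boolSign (ε l) • (X ε ^ (2 * p + 1) * D l) := by
      rw [show 2 * (p + 1) = 2 * p + 1 + 1 by ring, pow_succ]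
      nth_rw 2 [hXdef]
      rw [rademacherSum, Finset.mul_sum]
      exact Finset.sum_congr rfl fun l _ => mul_smul_comm _ _ _
    rw [this, opTrace_sum]
    exact Finset.sum_congr rfl fun l _ => opTrace_smul _ _
  have h2 : ∀ l, ∑ ε, boolSign (ε l) * opTrace (X ε ^ (2 * p + 1) * D l) ≤
      2 * (2 * p + 1) * ‖D l‖ ^ 2 * ∑ ε, opTrace (X ε ^ (2 * p)) := by
    intro l
    -- Discrete integration by parts: averaging each sign vector with its flip at `l` turns the
    -- trace into one of `X ^ (2p+1) - Y ^ (2p+1)`, where `X - Y = ± 2 D l`. Telescoping gives `2p +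
    -- 1` terms.
    have hflip : ∑ ε, boolSign (ε l) * opTrace (X ε ^ (2 * p + 1) * D l) =
        -∑ ε, boolSign (ε l) * opTrace (X (flipSign l ε) ^ (2 * p + 1) * D l) := by
      rw [← Equiv.sum_comp (flipSign l), ← Finset.sum_neg_distrib]
      refine Finset.sum_congr rfl fun ε _ => ?_
      rw [flipSign_apply_self, boolSign_not, neg_mul]
    have hterm : ∀ ε, boolSign (ε l) * opTrace (X ε ^ (2 * p + 1) * D l) -
        boolSign (ε l) * opTrace (X (flipSign l ε) ^ (2 * p + 1) * D l) ≤
        2 * (2 * p + 1) * ‖D l‖ ^ 2 *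
          (opTrace (X ε ^ (2 * p)) + opTrace (X (flipSign l ε) ^ (2 * p))) := by
      intro ε
      have e1 : X ε ^ (2 * p + 1) * D l =
          (X ε ^ (2 * p + 1) - X (flipSign l ε) ^ (2 * p + 1)) * D l +
            X (flipSign l ε) ^ (2 * p + 1) * D l := by
        rw [sub_mul, sub_add_cancel]
      have e2 : (X ε ^ (2 * p + 1) - X (flipSign l ε) ^ (2 * p + 1)) * D l =
          (2 * boolSign (ε l)) • ∑ q ∈ Finset.range (2 * p + 1),
            X ε ^ q * D l * X (flipSign l ε) ^ (2 * p - q) * D l := by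
        rw [pow_sub_pow_eq_sum, rademacherSum_sub_flipSign, Finset.sum_mul, Finset.smul_sum]
        refine Finset.sum_congr rfl fun q _ => ?_
        simp only [Nat.add_sub_cancel, mul_smul_comm, smul_mul_assoc]
      rw [e1, opTrace_add, e2, opTrace_smul, opTrace_sum, mul_add, add_sub_cancel_right,
        ← mul_assoc, mul_left_comm, boolSign_mul_self, mul_one, mul_assoc 2, mul_assoc 2]
      gcongr
      calc _ ≤ ∑ _q ∈ Finset.range (2 * p + 1), ‖D l‖ ^ 2 *
            (opTrace (X ε ^ (2 * p)) + opTrace (X (flipSign l ε) ^ (2 * p))) := by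
            refine Finset.sum_le_sum fun q hq => ?_
            refine opTrace_pow_mul_mul_pow_mul_le (hX _) (hX _) (hD l) ?_
            have := Finset.mem_range.1 hq
            omega
        _ = _ := by
            rw [Finset.sum_const, Finset.card_range, nsmul_eq_mul]
            push_cast
            ring
    have hsum := Finset.sum_le_sum fun ε (_ : ε ∈ Finset.univ) => hterm ε
    rw [Finset.sum_sub_distrib, ← Finset.mul_sum, Finset.sum_add_distrib,
      Equiv.sum_comp (flipSign l) fun ε => opTrace (X ε ^ (2 * p))] at hsum
    linarith
  calc _ = ∑ l, ∑ ε, boolSign (ε l) * opTrace (X ε ^ (2 * p + 1) * D l) := by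
        rw [Finset.sum_comm]
        exact Finset.sum_congr rfl fun ε _ => h1 ε
    _ ≤ ∑ l, 2 * (2 * p + 1) * ‖D l‖ ^ 2 * ∑ ε, opTrace (X ε ^ (2 * p)) :=
        Finset.sum_le_sum fun l _ => h2 l
    _ = _ := by rw [← Finset.sum_mul, ← Finset.mul_sum]

/-- Noncommutative Khintchine inequality. -/
lemma sum_opTrace_rademacherSum_pow_le {n : ℕ} {D : Fin n → V →L[ℝ] V}
    (hD : ∀ l, IsSelfAdjoint (D l)) (p : ℕ) :
    ∑ ε, opTrace (rademacherSum D ε ^ (2 * p)) ≤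
      2 ^ n * Module.finrank ℝ V * (∑ l, ‖D l‖ ^ 2) ^ p *
        ((2 * p).factorial / p.factorial) := by
  induction p with
  | zero => simp [opTrace_one]
  | succ p ih =>
    have hv : 0 ≤ ∑ l, ‖D l‖ ^ 2 := Finset.sum_nonneg fun _ _ => by positivity
    refine (sum_opTrace_rademacherSum_pow_succ_le hD p).trans ?_
    calc _ ≤ 2 * (2 * p + 1) * (∑ l, ‖D l‖ ^ 2) * (2 ^ n * Module.finrank ℝ V *
          (∑ l, ‖D l‖ ^ 2) ^ p * ((2 * p).factorial / p.factorial)) := by gcongr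
      _ = _ := by
        -- The factor `2 (2p + 1)` is the ratio of consecutive values of `(2p)! / p!`.
        rw [show 2 * (p + 1) = 2 * p + 1 + 1 by ring, Nat.factorial_succ, Nat.factorial_succ,
          Nat.factorial_succ]
        push_cast
        field_simp
        ring

/-- A Rademacher sum of self-adjoint operators of norm at most `b` has a sub-Gaussian norm. -/
theorem sum_cosh_norm_rademacherSum_le [Nontrivial V] {n : ℕ} (D : Fin n → V →L[ℝ] V)
    (hD : ∀ l, IsSelfAdjoint (D l)) {b : ℝ} (hb : ∀ l, ‖D l‖ ≤ b) (θ : ℝ) :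
    ∑ ε : Fin n → Bool, Real.cosh (θ * ‖rademacherSum D ε‖) ≤
      2 ^ n * (Module.finrank ℝ V * Real.exp (n * (θ * b) ^ 2)) := by
  set v := ∑ l, ‖D l‖ ^ 2 with hvdef
  have hL : HasSum (fun p : ℕ => ∑ ε : Fin n → Bool,
      (θ * ‖rademacherSum D ε‖) ^ (2 * p) / ((2 * p).factorial : ℝ))
      (∑ ε : Fin n → Bool, Real.cosh (θ * ‖rademacherSum D ε‖)) :=
    hasSum_sum fun ε _ => Real.hasSum_cosh _
  have hR : HasSum (fun p : ℕ => 2 ^ n * Module.finrank ℝ V *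
      ((θ ^ 2 * v) ^ p / (p.factorial : ℝ)))
      (2 ^ n * Module.finrank ℝ V * Real.exp (θ ^ 2 * v)) := by
    refine HasSum.mul_left _ ?_
    rw [Real.exp_eq_exp_ℝ]
    exact NormedSpace.expSeries_div_hasSum_exp (θ ^ 2 * v)
  have hle : ∑ ε : Fin n → Bool, Real.cosh (θ * ‖rademacherSum D ε‖) ≤
      2 ^ n * Module.finrank ℝ V * Real.exp (θ ^ 2 * v) := by
    -- The `(2p)!` of the moment bound cancels against the `cosh` series, leaving the exponential
    -- series in `θ ^ 2 * v`.
    refine hasSum_le (fun p => ?_) hL hR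
    have h1 : ∑ ε, ‖rademacherSum D ε‖ ^ (2 * p) ≤ _ :=
      (Finset.sum_le_sum fun ε _ =>
        norm_pow_even_le_opTrace (isSelfAdjoint_rademacherSum hD ε) p).trans
        (sum_opTrace_rademacherSum_pow_le hD p)
    have hθ : 0 ≤ θ ^ (2 * p) / ((2 * p).factorial : ℝ) := by rw [pow_mul]; positivity
    calc _ = θ ^ (2 * p) / ((2 * p).factorial : ℝ) *
          ∑ ε, ‖rademacherSum D ε‖ ^ (2 * p) := by
          rw [Finset.mul_sum]
          refine Finset.sum_congr rfl fun ε _ => ?_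
          rw [mul_pow]; ring
      _ ≤ _ := mul_le_mul_of_nonneg_left h1 hθ
      _ = _ := by
          rw [mul_pow, ← pow_mul]
          have : ((2 * p).factorial : ℝ) ≠ 0 := by positivity
          rw [← hvdef]
          field_simp
  refine hle.trans ?_
  rw [mul_assoc]
  have hv : v ≤ n * b ^ 2 := by
    calc v ≤ ∑ _l : Fin n, b ^ 2 := Finset.sum_le_sum fun l _ => by
          have := hb l
          gcongr
      _ = _ := by simp
  have hexp : θ ^ 2 * v ≤ n * (θ * b) ^ 2 := by
    calc θ ^ 2 * v ≤ θ ^ 2 * (n * b ^ 2) := by gcongr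
      _ = _ := by ring
  gcongr

end Operator

/-! ### Sampling without replacement from a finite population -/

lemma convexOn_cosh_mul_norm {V : Type*} [SeminormedAddCommGroup V] [NormedSpace ℝ V] {θ : ℝ}
    (hθ : 0 ≤ θ) : ConvexOn ℝ Set.univ fun v : V => Real.cosh (θ * ‖v‖) := by
  refine ⟨convex_univ, fun x _ y _ a b ha hb hab => ?_⟩
  have hexp := convexOn_exp
  have h1 : Real.cosh (θ * ‖a • x + b • y‖) ≤ Real.cosh (a * (θ * ‖x‖) + b * (θ * ‖y‖)) := by
    rw [Real.cosh_le_cosh, abs_of_nonneg (by positivity), abs_of_nonneg (by positivity)]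
    calc θ * ‖a • x + b • y‖ ≤ θ * (‖a • x‖ + ‖b • y‖) := by
          gcongr; exact norm_add_le _ _
      _ = _ := by
          rw [norm_smul, norm_smul, Real.norm_of_nonneg ha, Real.norm_of_nonneg hb]; ring
  refine h1.trans ?_
  have h2 := hexp.2 (Set.mem_univ (θ * ‖x‖)) (Set.mem_univ (θ * ‖y‖)) ha hb hab
  have h3 := hexp.2 (Set.mem_univ (-(θ * ‖x‖))) (Set.mem_univ (-(θ * ‖y‖))) ha hb hab
  have e3 : -(a * (θ * ‖x‖) + b * (θ * ‖y‖)) = a * -(θ * ‖x‖) + b * -(θ * ‖y‖) := by ring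
  simp only [smul_eq_mul] at *
  rw [Real.cosh_eq, Real.cosh_eq, Real.cosh_eq, e3]
  linarith

/-- Composition with a transposition shows that a uniformly random permutation sends `l` to a
uniformly distributed point. -/
lemma card_smul_sum_perm_apply {U M : Type*} [Fintype U] [DecidableEq U] [AddCommMonoid M]
    (b : U → M) (l : U) :
    Fintype.card U • ∑ τ : Equiv.Perm U, b (τ l) = Fintype.card (Equiv.Perm U) • ∑ u, b u := by
  have h : ∀ u : U, ∑ τ : Equiv.Perm U, b (τ u) = ∑ τ : Equiv.Perm U, b (τ l) := by
    intro u
    rw [← Equiv.sum_comp (Equiv.mulRight (Equiv.swap l u)) fun τ : Equiv.Perm U => b (τ u)]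
    simp
  calc _ = ∑ u : U, ∑ τ : Equiv.Perm U, b (τ u) := by
        rw [Finset.sum_congr rfl fun u _ => h u, Finset.sum_const, Finset.card_univ]
    _ = ∑ τ : Equiv.Perm U, ∑ u, b (τ u) := Finset.sum_comm
    _ = _ := by
        rw [Finset.sum_congr rfl fun τ _ => Equiv.sum_comp τ b, Finset.sum_const, Finset.card_univ]

/-- An ordering of the population whose first `n` and next `n` members are two disjoint samples. -/
abbrev Ordering (n R N : ℕ) := Fin n ⊕ (Fin n ⊕ Fin R) ≃ Fin N

/-- The sample formed by the first `n` members. -/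
def Ordering.sample {n R N : ℕ} (σ : Ordering n R N) : Finset (Fin N) :=
  Finset.univ.image fun l => σ (Sum.inl l)

lemma Ordering.inl_injective {n R N : ℕ} (σ : Ordering n R N) :
    Function.Injective fun l => σ (Sum.inl l) :=
  σ.injective.comp Sum.inl_injective

lemma Ordering.card_sample {n R N : ℕ} (σ : Ordering n R N) : σ.sample.card = n := by
  rw [sample, Finset.card_image_of_injective _ σ.inl_injective, Finset.card_univ, Fintype.card_fin]

lemma Ordering.sum_sample {n R N : ℕ} (σ : Ordering n R N) {M : Type*} [AddCommMonoid M]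
    (a : Fin N → M) : ∑ i ∈ σ.sample, a i = ∑ l, a (σ (Sum.inl l)) :=
  Finset.sum_image σ.inl_injective.injOn

lemma Ordering.exists_sample_eq {n R N : ℕ} (hN : n + (n + R) = N) {T : Finset (Fin N)}
    (hT : T.card = n) : ∃ σ : Ordering n R N, σ.sample = T := by
  classical
  have e1 : Fin n ≃ {i // i ∈ T} := Fintype.equivOfCardEq (by simp [hT])
  have e2 : Fin n ⊕ Fin R ≃ {i // ¬ i ∈ T} :=
    Fintype.equivOfCardEq (by
      rw [Fintype.card_subtype_compl]
      simp [hT]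
      omega)
  refine ⟨(Equiv.sumCongr e1 e2).trans (Equiv.sumCompl fun i => i ∈ T), ?_⟩
  refine Finset.eq_of_subset_of_card_le ?_ (by rw [card_sample, hT])
  intro i hi
  obtain ⟨l, -, rfl⟩ := Finset.mem_image.1 hi
  simp

lemma Ordering.sample_trans {n R N : ℕ} (σ : Ordering n R N) (π : Equiv.Perm (Fin N)) :
    Ordering.sample (σ.trans π) = σ.sample.image π := by
  rw [sample, sample, Finset.image_image]
  rfl

/-- A permutation of the population that carries `T` to `T'` maps one fiber bijectively onto the
other. -/
lemma Ordering.card_fiber_eq {n R N : ℕ} (hN : n + (n + R) = N) {T T' : Finset (Fin N)}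
    (hT : T.card = n) (hT' : T'.card = n) :
    (Finset.univ.filter fun σ : Ordering n R N => σ.sample = T).card =
      (Finset.univ.filter fun σ : Ordering n R N => σ.sample = T').card := by
  obtain ⟨σ₁, h₁⟩ := exists_sample_eq (R := R) hN hT
  obtain ⟨σ₂, h₂⟩ := exists_sample_eq (R := R) hN hT'
  have hπ : T.image (σ₁.symm.trans σ₂) = T' := by
    rw [← h₁, ← sample_trans, ← h₂]
    congr 1
    ext u
    simp
  have hinj : Function.Injective fun S : Finset (Fin N) => S.image (σ₁.symm.trans σ₂) :=
    Finset.image_injective (σ₁.symm.trans σ₂).injective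
  refine Finset.card_equiv (Equiv.equivCongr (Equiv.refl _) (σ₁.symm.trans σ₂)) fun σ => ?_
  simp only [Finset.mem_filter, Finset.mem_univ, true_and]
  have : Equiv.equivCongr (Equiv.refl _) (σ₁.symm.trans σ₂) σ = σ.trans (σ₁.symm.trans σ₂) := by
    ext u; simp
  rw [this, sample_trans, ← hπ]
  exact hinj.eq_iff.symm

/-- A uniformly random ordering yields a uniformly random sample. -/
lemma Ordering.sum_comp_sample {n R N : ℕ} (hN : n + (n + R) = N) (g : Finset (Fin N) → ℝ) :
    (N.choose n : ℝ) * ∑ σ : Ordering n R N, g σ.sample =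
      Fintype.card (Ordering n R N) * ∑ T ∈ Finset.powersetCard n Finset.univ, g T := by
  obtain ⟨T₀, -, hT₀⟩ := Finset.exists_subset_card_eq (s := (Finset.univ : Finset (Fin N)))
    (n := n) (by simp; omega)
  set c := (Finset.univ.filter fun σ : Ordering n R N => σ.sample = T₀).card with hc
  have hsum : ∀ h : Finset (Fin N) → ℝ, ∑ σ : Ordering n R N, h σ.sample =
      c * ∑ T ∈ Finset.powersetCard n Finset.univ, h T := by
    intro h
    rw [← Finset.sum_fiberwise_of_maps_to (s := Finset.univ)
      (t := Finset.powersetCard n Finset.univ) (g := fun σ : Ordering n R N => σ.sample)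
      fun σ _ => Finset.mem_powersetCard.2 ⟨Finset.subset_univ _, σ.card_sample⟩, Finset.mul_sum]
    refine Finset.sum_congr rfl fun T hT => ?_
    rw [hc, card_fiber_eq hN hT₀ (Finset.mem_powersetCard.1 hT).2,
      Finset.sum_congr rfl fun σ hσ => by rw [(Finset.mem_filter.1 hσ).2], Finset.sum_const,
      nsmul_eq_mul]
  -- The constant function determines the common fiber size `c`.
  have h1 := hsum fun _ => 1
  simp only [Finset.sum_const, nsmul_eq_mul, mul_one, Finset.card_univ, Finset.card_powersetCard,
    Fintype.card_fin] at h1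
  rw [hsum, h1]
  ring

/-- Exchange the `l`-th members of the two samples for each `l` with `ε l = false`. -/
def exchange {n R : ℕ} (ε : Fin n → Bool) : Equiv.Perm (Fin n ⊕ (Fin n ⊕ Fin R)) :=
  Function.Involutive.toPerm
    (fun u => match u with
      | Sum.inl l => if ε l then Sum.inl l else Sum.inr (Sum.inl l)
      | Sum.inr (Sum.inl l) => if ε l then Sum.inr (Sum.inl l) else Sum.inl l
      | Sum.inr (Sum.inr r) => Sum.inr (Sum.inr r))
    (by
      rintro (l | l | r)
      · by_cases h : ε l <;> simp [h]
      · by_cases h : ε l <;> simp [h]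
      · rfl)

lemma exchange_inl {n R : ℕ} (ε : Fin n → Bool) (l : Fin n) :
    exchange (R := R) ε (Sum.inl l) = if ε l then Sum.inl l else Sum.inr (Sum.inl l) := rfl

lemma exchange_inr_inl {n R : ℕ} (ε : Fin n → Bool) (l : Fin n) :
    exchange (R := R) ε (Sum.inr (Sum.inl l)) = if ε l then Sum.inr (Sum.inl l) else Sum.inl l :=
  rfl

section

variable {V : Type*} [NormedAddCommGroup V] [NormedSpace ℝ V]

/-- The differences of the paired members of the two samples. -/
def Ordering.diff {n R N : ℕ} (a : Fin N → V) (σ : Ordering n R N) (l : Fin n) : V :=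
  a (σ (Sum.inl l)) - a (σ (Sum.inr (Sum.inl l)))

lemma Ordering.sum_diff_exchange {n R N : ℕ} (a : Fin N → V) (σ : Ordering n R N)
    (ε : Fin n → Bool) :
    ∑ l, Ordering.diff a ((exchange ε).trans σ) l = rademacherSum (Ordering.diff a σ) ε := by
  rw [rademacherSum]
  refine Finset.sum_congr rfl fun l _ => ?_
  simp only [Ordering.diff, Equiv.trans_apply, exchange_inl, exchange_inr_inl, boolSign]
  cases ε l <;> simp

/-- Symmetrization: each exchange permutes the orderings, so the sum over orderings is unchanged
when signs are inserted and averaged. -/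
lemma Ordering.sum_cosh_norm_sum_diff_le {n R N : ℕ} (a : Fin N → V) {θ B : ℝ}
    (hB : ∀ σ : Ordering n R N,
      ∑ ε, Real.cosh (θ * ‖rademacherSum (Ordering.diff a σ) ε‖) ≤ 2 ^ n * B) :
    ∑ σ : Ordering n R N, Real.cosh (θ * ‖∑ l, Ordering.diff a σ l‖) ≤
      Fintype.card (Ordering n R N) * B := by
  have h1 : ∀ ε : Fin n → Bool,
      ∑ σ : Ordering n R N, Real.cosh (θ * ‖rademacherSum (Ordering.diff a σ) ε‖) =
      ∑ σ : Ordering n R N, Real.cosh (θ * ‖∑ l, Ordering.diff a σ l‖) := by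
    intro ε
    rw [← Equiv.sum_comp (Equiv.equivCongr (exchange (R := R) ε).symm (Equiv.refl (Fin N)))
      fun σ : Ordering n R N => Real.cosh (θ * ‖∑ l, Ordering.diff a σ l‖)]
    refine Finset.sum_congr rfl fun σ _ => ?_
    rw [← sum_diff_exchange]
    rfl
  have h2 := Finset.sum_le_sum fun σ (_ : σ ∈ Finset.univ) => hB σ
  rw [Finset.sum_comm, Finset.sum_congr rfl fun ε _ => h1 ε] at h2
  simp only [Finset.sum_const, Finset.card_univ, nsmul_eq_mul, Fintype.card_fun, Fintype.card_bool,
    Fintype.card_fin, Nat.cast_pow, Nat.cast_ofNat] at h2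
  have hpos : (0 : ℝ) < 2 ^ n := by positivity
  nlinarith [h2]

/-- Deviation of a sample sum from its mean. -/
noncomputable def sampleDev {N : ℕ} (a : Fin N → V) (T : Finset (Fin N)) : V :=
  ∑ i ∈ T, a i - ((T.card : ℝ) / N) • ∑ i, a i

/-- Averaging over the order of the remaining population. -/
lemma Ordering.sum_perm_sum_diff {n R N : ℕ} (hN : n + (n + R) = N) (hn : 0 < n) (a : Fin N → V)
    (σ : Ordering n R N) :
    ∑ τ : Equiv.Perm (Fin n ⊕ Fin R),
        ∑ l, Ordering.diff a ((Equiv.sumCongr (Equiv.refl (Fin n)) τ).trans σ) l =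
      ((Fintype.card (Equiv.Perm (Fin n ⊕ Fin R)) : ℝ) * (N / (n + R : ℝ))) •
        sampleDev a σ.sample := by
  set P : ℝ := (Fintype.card (Equiv.Perm (Fin n ⊕ Fin R)) : ℝ)
  have hR : (0 : ℝ) < (n : ℝ) + R := by positivity
  have hN' : (N : ℝ) = n + (n + R) := by exact_mod_cast hN.symm
  have hNpos : (0 : ℝ) < N := by rw [hN']; positivity
  set S := ∑ i ∈ σ.sample, a i
  set Q := ∑ u : Fin n ⊕ Fin R, a (σ (Sum.inr u))
  have hall : ∑ i, a i = S + Q := by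
    rw [← Equiv.sum_comp σ, Fintype.sum_sum_type]
    congr 1
    exact (σ.sum_sample a).symm
  have hQ : ∀ l : Fin n, ∑ τ : Equiv.Perm (Fin n ⊕ Fin R), a (σ (Sum.inr (τ (Sum.inl l)))) =
      (P / (n + R)) • Q := by
    intro l
    have h := card_smul_sum_perm_apply (fun u : Fin n ⊕ Fin R => a (σ (Sum.inr u))) (Sum.inl l)
    rw [← Nat.cast_smul_eq_nsmul ℝ, ← Nat.cast_smul_eq_nsmul ℝ, Fintype.card_sum,
      Fintype.card_fin, Fintype.card_fin, Nat.cast_add] at h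
    rw [div_eq_inv_mul, mul_smul, ← h, smul_smul, inv_mul_cancel₀ hR.ne', one_smul]
  have hlhs : ∑ τ : Equiv.Perm (Fin n ⊕ Fin R),
        ∑ l, Ordering.diff a ((Equiv.sumCongr (Equiv.refl (Fin n)) τ).trans σ) l =
      P • S - (n : ℝ) • (P / (n + R)) • Q := by
    rw [Finset.sum_comm]
    simp only [Ordering.diff, Equiv.trans_apply, Equiv.sumCongr_apply, Sum.map_inl, Sum.map_inr,
      Equiv.refl_apply, Finset.sum_sub_distrib, hQ]
    congr 1
    · rw [Finset.sum_comm, Finset.sum_const, Finset.card_univ, ← σ.sum_sample,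
        Nat.cast_smul_eq_nsmul]
    · rw [Finset.sum_const, Finset.card_univ, Fintype.card_fin, Nat.cast_smul_eq_nsmul]
  rw [hlhs, sampleDev, hall, σ.card_sample, smul_sub, smul_add, smul_add, smul_smul, smul_smul,
    smul_smul]
  change P • S - (n * (P / (n + R))) • Q = (P * (N / (n + R))) • S - _
  have e1 : P * (N / (n + R)) * (n / N) = n * (P / (n + R)) := by
    field_simp
  -- Since `N = n + (n + R)`, the centring `(n / N) ∑ a` and the factor `N / (n + R)` combine to
  -- coefficient `P` on the first sample.
  have e2 : P * (N / (n + R)) - n * (P / (n + R)) = P := by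
    rw [hN']
    field_simp
    ring
  rw [e1, ← sub_sub, ← sub_smul, e2]

/-- Sampling without replacement: the exponential moment of the deviation is controlled by
Rademacher sums. -/
theorem sum_cosh_norm_sampleDev_le {n N : ℕ} (hn : 0 < n) (hnN : 2 * n ≤ N) (a : Fin N → V)
    {θ B : ℝ} (hθ : 0 ≤ θ)
    (hB : ∀ i j : Fin n → Fin N,
      ∑ ε, Real.cosh (θ * ‖rademacherSum (fun l => a (i l) - a (j l)) ε‖) ≤ 2 ^ n * B) :
    ∑ T ∈ Finset.powersetCard n Finset.univ, Real.cosh (θ * ‖sampleDev a T‖) ≤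
      N.choose n * B := by
  obtain ⟨R, hR⟩ : ∃ R, n + (n + R) = N := ⟨N - 2 * n, by omega⟩
  set P : ℝ := (Fintype.card (Equiv.Perm (Fin n ⊕ Fin R)) : ℝ) with hP
  have hPpos : 0 < P := by rw [hP]; exact_mod_cast Fintype.card_pos
  have hN' : (N : ℝ) = n + (n + R) := by exact_mod_cast hR.symm
  have hnR : (0 : ℝ) < (n : ℝ) + R := by positivity
  have hcard : 0 < (Fintype.card (Ordering n R N) : ℝ) := by
    obtain ⟨T, -, hT⟩ := Finset.exists_subset_card_eq (s := (Finset.univ : Finset (Fin N)))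
      (n := n) (by simp; omega)
    obtain ⟨σ, -⟩ := Ordering.exists_sample_eq hR hT
    have : Nonempty (Ordering n R N) := ⟨σ⟩
    exact_mod_cast Fintype.card_pos
  have hJ : ∀ σ : Ordering n R N, P * Real.cosh (θ * ‖sampleDev a σ.sample‖) ≤
      ∑ τ : Equiv.Perm (Fin n ⊕ Fin R), Real.cosh (θ *
        ‖∑ l, Ordering.diff a ((Equiv.sumCongr (Equiv.refl (Fin n)) τ).trans σ) l‖) := by
    intro σ
    -- Jensen over the uniformly random order `τ` of the members outside the first sample.
    have h := (convexOn_cosh_mul_norm (V := V) hθ).map_sum_le (t := Finset.univ)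
      (w := fun _ : Equiv.Perm (Fin n ⊕ Fin R) => P⁻¹)
      (p := fun τ => ∑ l, Ordering.diff a ((Equiv.sumCongr (Equiv.refl (Fin n)) τ).trans σ) l)
      (fun _ _ => by positivity)
      (by rw [Finset.sum_const, Finset.card_univ, nsmul_eq_mul, ← hP, mul_inv_cancel₀ hPpos.ne'])
      (fun _ _ => Set.mem_univ _)
    simp only [smul_eq_mul, ← Finset.smul_sum, ← Finset.mul_sum] at h
    rw [Ordering.sum_perm_sum_diff hR hn, smul_smul, ← mul_assoc, ← hP,
      inv_mul_cancel₀ hPpos.ne', one_mul, norm_smul] at h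
    have h1 : Real.cosh (θ * ‖sampleDev a σ.sample‖) ≤
        Real.cosh (θ * (‖(N : ℝ) / (n + R)‖ * ‖sampleDev a σ.sample‖)) := by
      rw [Real.cosh_le_cosh, abs_of_nonneg (by positivity), abs_of_nonneg (by positivity)]
      gcongr
      refine le_mul_of_one_le_left (norm_nonneg _) ?_
      rw [Real.norm_of_nonneg (by positivity), one_le_div hnR, hN']
      linarith [(Nat.cast_nonneg n : (0 : ℝ) ≤ n)]
    have h2 := mul_le_mul_of_nonneg_left (h1.trans h) hPpos.le
    rwa [← mul_assoc, mul_inv_cancel₀ hPpos.ne', one_mul] at h2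
  have hsum : ∑ σ : Ordering n R N, Real.cosh (θ * ‖sampleDev a σ.sample‖) ≤
      Fintype.card (Ordering n R N) * B := by
    have h := Finset.sum_le_sum fun σ (_ : σ ∈ Finset.univ) => hJ σ
    rw [← Finset.mul_sum, Finset.sum_comm] at h
    have hτ : ∀ τ : Equiv.Perm (Fin n ⊕ Fin R), ∑ σ : Ordering n R N, Real.cosh (θ *
        ‖∑ l, Ordering.diff a ((Equiv.sumCongr (Equiv.refl (Fin n)) τ).trans σ) l‖) =
        ∑ σ : Ordering n R N, Real.cosh (θ * ‖∑ l, Ordering.diff a σ l‖) := by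
      intro τ
      rw [← Equiv.sum_comp (Equiv.equivCongr (Equiv.sumCongr (Equiv.refl (Fin n)) τ).symm
        (Equiv.refl (Fin N))) fun σ : Ordering n R N =>
          Real.cosh (θ * ‖∑ l, Ordering.diff a σ l‖)]
      rfl
    rw [Finset.sum_congr rfl fun τ _ => hτ τ, Finset.sum_const, Finset.card_univ, nsmul_eq_mul,
      ← hP] at h
    exact (le_of_mul_le_mul_left h hPpos).trans
      (Ordering.sum_cosh_norm_sum_diff_le a fun σ => hB _ _)
  have hE := Ordering.sum_comp_sample hR fun T => Real.cosh (θ * ‖sampleDev a T‖)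
  have h3 := mul_le_mul_of_nonneg_left hsum (Nat.cast_nonneg (α := ℝ) (N.choose n))
  rw [hE, mul_left_comm] at h3
  exact le_of_mul_le_mul_left h3 hcard

end

/-! ### Tail bounds for sampling without replacement -/

section

variable {V : Type*} [NormedAddCommGroup V] [NormedSpace ℝ V]

/-- Rademacher sums of differences within the population `a` have sub-Gaussian norms, with
prefactor `K` and scale `2 r`. -/
def SubGaussianDifferences {N : ℕ} (a : Fin N → V) (r K : ℝ) : Prop :=
  ∀ (n : ℕ) (i j : Fin n → Fin N) (θ : ℝ),
    ∑ ε, Real.cosh (θ * ‖rademacherSum (fun l => a (i l) - a (j l)) ε‖) ≤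
      2 ^ n * (K * Real.exp (n * (θ * (2 * r)) ^ 2))

lemma sampleDev_compl {N : ℕ} (hN : 0 < N) (a : Fin N → V) (T : Finset (Fin N)) :
    sampleDev a Tᶜ = -sampleDev a T := by
  have hN' : (N : ℝ) ≠ 0 := by positivity
  have hT : T.card ≤ N := by simpa using T.card_le_univ
  have h1 : ∑ i ∈ Tᶜ, a i = ∑ i, a i - ∑ i ∈ T, a i :=
    eq_sub_of_add_eq' (Finset.sum_add_sum_compl T a)
  rw [sampleDev, sampleDev, Finset.card_compl, Fintype.card_fin, Nat.cast_sub hT, sub_div,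
    div_self hN', sub_smul, one_smul, h1]
  abel

/-- Chernoff bound. The chosen `θ` minimizes `4 q r² θ² - θ τ`; the moment exponent is then `c` and
`θ τ = 2 c`. The factor `2` comes from `cosh y ≥ exp y / 2`. -/
lemma card_lt_norm_sampleDev_le {q N : ℕ} (hq : 0 < q) (hqN : 2 * q ≤ N) {a : Fin N → V}
    {r K τ : ℝ} (ha : SubGaussianDifferences a r K) (hr : 0 < r) (hτ : 0 < τ) :
    (((Finset.powersetCard q Finset.univ).filter fun T => τ < ‖sampleDev a T‖).card : ℝ) ≤
      N.choose q * (2 * K * Real.exp (-(τ ^ 2 / (16 * q * r ^ 2)))) := by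
  have hq' : (0 : ℝ) < q := by exact_mod_cast hq
  set θ := τ / (8 * q * r ^ 2) with hθ
  have hθpos : 0 < θ := by positivity
  set c := τ ^ 2 / (16 * q * r ^ 2) with hc
  have hsum := sum_cosh_norm_sampleDev_le hq hqN a hθpos.le fun i j => ha q i j θ
  have e1 : (q : ℝ) * (θ * (2 * r)) ^ 2 = c := by
    rw [hθ, hc]; field_simp; norm_num
  have e2 : θ * τ = c + c := by
    rw [hθ, hc]; field_simp; norm_num
  rw [e1] at hsum
  have hlow : (((Finset.powersetCard q Finset.univ).filter
      fun T => τ < ‖sampleDev a T‖).card : ℝ) * Real.cosh (θ * τ) ≤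
      ∑ T ∈ Finset.powersetCard q Finset.univ, Real.cosh (θ * ‖sampleDev a T‖) := by
    rw [← nsmul_eq_mul, ← Finset.sum_const]
    refine (Finset.sum_le_sum fun T hT => ?_).trans
      (Finset.sum_le_sum_of_subset_of_nonneg (Finset.filter_subset _ _)
        fun _ _ _ => (Real.cosh_pos _).le)
    rw [Real.cosh_le_cosh, abs_of_nonneg (by positivity), abs_of_nonneg (by positivity)]
    have := (Finset.mem_filter.1 hT).2
    gcongr
  have hcosh : Real.exp c * Real.exp c / 2 ≤ Real.cosh (θ * τ) := by
    rw [e2, Real.cosh_eq, Real.exp_add]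
    linarith [Real.exp_pos (-(c + c))]
  have h1 := (mul_le_mul_of_nonneg_left hcosh (Nat.cast_nonneg _)).trans (hlow.trans hsum)
  rw [Real.exp_neg]
  have hE := Real.exp_pos c
  refine le_of_mul_le_mul_right ?_ (by positivity : 0 < Real.exp c * Real.exp c / 2)
  refine h1.trans (le_of_eq ?_)
  field_simp

/-- Tail bound for the mean of a uniformly random sample without replacement. -/
theorem card_lt_norm_sampleMean_sub_mean_le {n N : ℕ} (hn : 0 < n) (hnN : n ≤ N) {a : Fin N → V}
    {r K t Λ : ℝ} (ha : SubGaussianDifferences a r K) (hr : 0 < r) (hK : 0 ≤ K) (ht : 0 < t)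
    (hΛ : 0 < Λ) (hsize : (1 / (N : ℝ) + t ^ 2 / (64 * r ^ 2 * Λ))⁻¹ ≤ (n : ℝ)) :
    (((Finset.powersetCard n Finset.univ).filter fun T =>
        t < ‖(1 / (n : ℝ)) • ∑ i ∈ T, a i - (1 / (N : ℝ)) • ∑ i, a i‖).card : ℝ) ≤
      N.choose n * (2 * K * Real.exp (-Λ)) := by
  have hn' : (0 : ℝ) < n := by exact_mod_cast hn
  have hN : 0 < N := hn.trans_le hnN
  have hN' : (0 : ℝ) < N := by exact_mod_cast hN
  have hdev : ∀ T ∈ Finset.powersetCard n (Finset.univ : Finset (Fin N)),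
      (t < ‖(1 / (n : ℝ)) • ∑ i ∈ T, a i - (1 / (N : ℝ)) • ∑ i, a i‖ ↔
        n * t < ‖sampleDev a T‖) := by
    intro T hT
    have : sampleDev a T =
        (n : ℝ) • ((1 / (n : ℝ)) • ∑ i ∈ T, a i - (1 / (N : ℝ)) • ∑ i, a i) := by
      rw [sampleDev, (Finset.mem_powersetCard.1 hT).2, smul_sub, smul_smul, smul_smul,
        mul_one_div_cancel hn'.ne', one_smul, mul_one_div]
    rw [this, norm_smul, Real.norm_of_nonneg hn'.le]
    exact (mul_lt_mul_iff_right₀ hn').symm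
  rw [Finset.filter_congr hdev]
  rcases hnN.eq_or_lt with rfl | hlt
  · rw [Finset.card_eq_zero.2, Nat.cast_zero]
    · positivity
    · refine Finset.filter_eq_empty_iff.2 fun T hT => ?_
      have hT' : T = Finset.univ := by
        rw [← Finset.card_eq_iff_eq_univ, (Finset.mem_powersetCard.1 hT).2, Fintype.card_fin]
      rw [hT', sampleDev, Finset.card_univ, Fintype.card_fin, div_self hn'.ne', one_smul, sub_self,
        norm_zero, not_lt]
      positivity
  · have hlt' : (n : ℝ) < N := by exact_mod_cast hlt
    -- The size condition in the form `1 / n - 1 / N ≤ t² / (64 r² Λ)`, with denominators cleared.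
    have hvar : 64 * r ^ 2 * Λ * (n * (N - n)) ≤ (n * t) ^ 2 * N := by
      have h1 : 1 / (n : ℝ) ≤ 1 / N + t ^ 2 / (64 * r ^ 2 * Λ) := by
        rw [one_div (n : ℝ)]
        exact inv_le_of_inv_le₀ (by positivity) hsize
      have h2 : 1 / (n : ℝ) - 1 / N = (N - n) / (n * N) := by field_simp
      have h3 : ((N : ℝ) - n) / (n * N) ≤ t ^ 2 / (64 * r ^ 2 * Λ) := by linarith
      rw [div_le_div_iff₀ (by positivity) (by positivity)] at h3
      nlinarith
    -- Here `q = min n (N - n)`, for which `q N ≤ 2 n (N - n)`. The constant `64` leaves a spare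
    -- factor of `2`.
    have hexp : ∀ q : ℕ, 0 < q → (q : ℝ) * N ≤ 2 * (n * (N - n)) →
        Λ ≤ (n * t) ^ 2 / (16 * q * r ^ 2) := by
      intro q hq hqN
      have hq' : (0 : ℝ) < q := by exact_mod_cast hq
      rw [le_div_iff₀ (by positivity)]
      have h1 : 32 * r ^ 2 * Λ * (q * N) ≤ 32 * r ^ 2 * Λ * (2 * (n * (N - n))) := by gcongr
      have h2 : (32 * r ^ 2 * Λ * q) * N ≤ (n * t) ^ 2 * N := by linarith
      have h3 := le_of_mul_le_mul_right h2 hN'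
      nlinarith [show 0 ≤ r ^ 2 * Λ * q by positivity]
    have hτ : 0 < (n : ℝ) * t := by positivity
    rcases le_total (2 * n) N with h | h
    · have h' : 2 * (n : ℝ) ≤ N := by exact_mod_cast h
      refine (card_lt_norm_sampleDev_le hn h ha hr hτ).trans ?_
      have := hexp n hn (by nlinarith)
      gcongr
    · have h' : (N : ℝ) ≤ 2 * n := by exact_mod_cast h
      have hq : 0 < N - n := by omega
      have hcard : ((Finset.powersetCard n (Finset.univ : Finset (Fin N))).filter
          fun T => n * t < ‖sampleDev a T‖).card =
          ((Finset.powersetCard (N - n) (Finset.univ : Finset (Fin N))).filter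
          fun T => n * t < ‖sampleDev a T‖).card := by
        refine Finset.card_nbij' compl compl ?_ ?_ (fun T _ => compl_compl T)
          fun T _ => compl_compl T
        · intro T hT
          simp only [Finset.coe_filter, Finset.mem_powersetCard, Set.mem_ofPred_eq] at hT ⊢
          rw [sampleDev_compl hN, norm_neg, Finset.card_compl, Fintype.card_fin, hT.1.2]
          exact ⟨⟨Finset.subset_univ _, rfl⟩, hT.2⟩
        · intro T hT
          simp only [Finset.coe_filter, Finset.mem_powersetCard, Set.mem_ofPred_eq] at hT ⊢
          rw [sampleDev_compl hN, norm_neg, Finset.card_compl, Fintype.card_fin, hT.1.2]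
          exact ⟨⟨Finset.subset_univ _, by omega⟩, hT.2⟩
      rw [hcard, ← Nat.choose_symm hnN]
      refine (card_lt_norm_sampleDev_le hq (by omega) ha hr hτ).trans ?_
      have := hexp (N - n) hq (by rw [Nat.cast_sub hnN]; nlinarith)
      gcongr

end

lemma norm_sub_le_two_mul {V : Type*} [SeminormedAddCommGroup V] {N : ℕ} {a : Fin N → V} {r : ℝ} (ha : ∀ i, ‖a i‖ ≤ r)
    (i j : Fin N) :
    ‖a i - a j‖ ≤ 2 * r := by
  have := norm_sub_le (a i) (a j)
  linarith [ha i, ha j]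

lemma subGaussianDifferences_of_inner {V : Type*} [NormedAddCommGroup V] [InnerProductSpace ℝ V]
    {N : ℕ} {a : Fin N → V} {r : ℝ} (ha : ∀ i, ‖a i‖ ≤ r) : SubGaussianDifferences a r 1 :=
  fun _ _ _ θ => sum_cosh_norm_rademacher_le _ (fun _ => norm_sub_le_two_mul ha _ _) θ

lemma subGaussianDifferences_of_isSelfAdjoint {V : Type*} [NormedAddCommGroup V]
    [InnerProductSpace ℝ V] [FiniteDimensional ℝ V] [CompleteSpace V] [Nontrivial V] {N : ℕ}
    {a : Fin N → V →L[ℝ] V} (hsa : ∀ i, IsSelfAdjoint (a i)) {r : ℝ} (ha : ∀ i, ‖a i‖ ≤ r) :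
    SubGaussianDifferences a r (Module.finrank ℝ V) :=
  fun _ _ _ θ => sum_cosh_norm_rademacherSum_le _ (fun _ => (hsa _).sub (hsa _))
    (fun _ => norm_sub_le_two_mul ha _ _) θ

/-! ### Conditioning on the past -/

open Classical in
/-- If at almost every point of an event known from the past at most a fraction `ζ` of the samples
of the given size is bad, then the sample is bad with probability at most `ζ` on this event. -/
lemma UniformWithoutReplacement.measure_inter_bad_le {Ω : Type*} {N : ℕ} {𝓖 : MeasurableSpace Ω}
    [mΩ : MeasurableSpace Ω] {μ : Measure Ω} (h𝓖 : 𝓖 ≤ mΩ) {R : Set Ω} {ξ : Ω → Finset (Fin N)}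
    (hξ : UniformWithoutReplacement μ 𝓖 R ξ) {A : Set Ω} (hA : MeasurableSet[𝓖] A)
    {bad : Finset (Fin N) → Set Ω} (hbad : ∀ T, MeasurableSet[𝓖] (bad T)) {ζ : ENNReal}
    (h : ∀ᵐ ω ∂μ, ω ∈ A → ω ∈ R ∧
      (((Finset.powersetCard (ξ ω).card Finset.univ).filter fun T => ω ∈ bad T).card : ENNReal) ≤
        ζ * N.choose (ξ ω).card) :
    μ (A ∩ {ω | ω ∈ bad (ξ ω)}) ≤ ζ * μ A := by
  -- Uniformity is only available for a fixed sample size, so `A` is split by the size, which the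
  -- past determines.
  set A' : ℕ → Set Ω := fun n => A ∩ (R ∩ {ω | (ξ ω).card = n}) with hA'
  have hA'm : ∀ n, MeasurableSet[𝓖] (A' n) := fun n => hA.inter (hξ.size_known n)
  have hdisj : ∀ n n', n ≠ n' → Disjoint (A' n) (A' n') := by
    intro n n' hne
    refine Set.disjoint_left.2 fun ω h1 h2 => hne ?_
    exact h1.2.2.symm.trans h2.2.2
  have hn : ∀ n ∈ Finset.range (N + 1),
      μ (A' n ∩ {ω | ω ∈ bad (ξ ω)}) ≤ ζ * μ (A' n) := by
    intro n hnN
    have hC : (N.choose n : ENNReal) ≠ 0 := by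
      exact_mod_cast (Nat.choose_pos (Nat.lt_succ_iff.1 (Finset.mem_range.1 hnN))).ne'
    have hC' : (N.choose n : ENNReal) ≠ ⊤ := ENNReal.natCast_ne_top _
    have hsub : A' n ∩ {ω | ω ∈ bad (ξ ω)} ⊆
        ⋃ T ∈ Finset.powersetCard n Finset.univ, (A' n ∩ bad T) ∩ {ω | ξ ω = T} := by
      intro ω hω
      refine Set.mem_biUnion (x := ξ ω)
        (Finset.mem_powersetCard.2 ⟨Finset.subset_univ _, hω.1.2.2⟩) ⟨⟨hω.1, hω.2⟩, rfl⟩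
    have hunif : ∀ T ∈ Finset.powersetCard n (Finset.univ : Finset (Fin N)),
        μ ((A' n ∩ bad T) ∩ {ω | ξ ω = T}) = μ (A' n ∩ bad T) / N.choose n := fun T hT =>
      hξ.uniform n _ ((hA'm n).inter (hbad T)) (fun ω hω => hω.1.2) T
        (Finset.mem_powersetCard.1 hT).2
    -- Exchanging sum and integral turns the left side into the integral of the number of bad
    -- samples at `ω`, which the hypothesis bounds pointwise.
    have hint : ∑ T ∈ Finset.powersetCard n (Finset.univ : Finset (Fin N)), μ (A' n ∩ bad T) ≤
        ζ * N.choose n * μ (A' n) := by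
      have e : ∀ T, μ (A' n ∩ bad T) = ∫⁻ ω in A' n, (bad T).indicator 1 ω ∂μ := by
        intro T
        rw [lintegral_indicator_one (h𝓖 _ (hbad T)), Measure.restrict_apply (h𝓖 _ (hbad T)),
          Set.inter_comm]
      rw [Finset.sum_congr rfl fun T _ => e T, ← lintegral_finsetSum _ fun T _ =>
        measurable_one.indicator (h𝓖 _ (hbad T)), ← setLIntegral_const]
      refine setLIntegral_mono_ae measurable_const.aemeasurable ?_
      filter_upwards [h] with ω hω hωA
      have h1 := (hω hωA.1).2
      rw [hωA.2.2] at h1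
      refine le_trans (le_of_eq ?_) h1
      rw [Finset.card_filter, Nat.cast_sum]
      refine Finset.sum_congr rfl fun T _ => ?_
      by_cases hb : ω ∈ bad T <;> simp [hb]
    calc μ (A' n ∩ {ω | ω ∈ bad (ξ ω)})
        ≤ ∑ T ∈ Finset.powersetCard n Finset.univ, μ ((A' n ∩ bad T) ∩ {ω | ξ ω = T}) :=
          (measure_mono hsub).trans (measure_biUnion_finset_le _ _)
      _ = (∑ T ∈ Finset.powersetCard n Finset.univ, μ (A' n ∩ bad T)) / N.choose n := by
          rw [Finset.sum_congr rfl hunif]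
          simp only [div_eq_mul_inv, Finset.sum_mul]
      _ ≤ (ζ * N.choose n * μ (A' n)) / N.choose n := by gcongr
      _ = ζ * μ (A' n) := by
          rw [mul_right_comm, ENNReal.mul_div_cancel_right hC hC']
  have hcover : ∀ᵐ ω ∂μ, ω ∈ A ∩ {ω | ω ∈ bad (ξ ω)} →
      ω ∈ ⋃ n ∈ Finset.range (N + 1), A' n ∩ {ω | ω ∈ bad (ξ ω)} := by
    filter_upwards [h] with ω hω hωA
    refine Set.mem_biUnion (x := (ξ ω).card) (Finset.mem_coe.2 (Finset.mem_range.2 ?_))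
      ⟨⟨hωA.1, (hω hωA.1).1, rfl⟩, hωA.2⟩
    have := (ξ ω).card_le_univ
    rw [Fintype.card_fin] at this
    omega
  calc μ (A ∩ {ω | ω ∈ bad (ξ ω)})
      ≤ ∑ n ∈ Finset.range (N + 1), μ (A' n ∩ {ω | ω ∈ bad (ξ ω)}) :=
        (measure_mono_ae hcover).trans (measure_biUnion_finset_le _ _)
    _ ≤ ∑ n ∈ Finset.range (N + 1), ζ * μ (A' n) := Finset.sum_le_sum hn
    _ = ζ * μ (⋃ n ∈ Finset.range (N + 1), A' n) := by
        rw [← Finset.mul_sum, measure_biUnion_finset (fun n _ n' _ => hdisj n n')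
          fun n _ => h𝓖 _ (hA'm n)]
    _ ≤ ζ * μ A := by
        gcongr
        exact Set.iUnion₂_subset fun n _ => Set.inter_subset_left

/-- Only subadditivity is used for `S` and its complement, so `S` need not be measurable. -/
lemma one_sub_le_cond_real {Ω : Type*} [MeasurableSpace Ω] {μ : Measure Ω} [IsProbabilityMeasure μ]
    {A S : Set Ω} (hA : MeasurableSet A) (hμA : μ A ≠ 0) {ζ : ℝ} (hζ : 0 ≤ ζ)
    (h : μ (A ∩ Sᶜ) ≤ ENNReal.ofReal ζ * μ A) : 1 - ζ ≤ (ProbabilityTheory.cond μ A).real S := by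
  have hprob := cond_isProbabilityMeasure (μ := μ) hμA
  have hc : (ProbabilityTheory.cond μ A).real Sᶜ ≤ ζ := by
    rw [measureReal_def, cond_apply hA]
    refine ENNReal.toReal_le_of_le_ofReal hζ ?_
    calc (μ A)⁻¹ * μ (A ∩ Sᶜ) ≤ (μ A)⁻¹ * (ENNReal.ofReal ζ * μ A) := by gcongr
      _ = ENNReal.ofReal ζ := by
        rw [mul_left_comm, ENNReal.inv_mul_cancel hμA (measure_ne_top μ A), mul_one]
  have h1 : (1 : ℝ) ≤ (ProbabilityTheory.cond μ A).real S +
      (ProbabilityTheory.cond μ A).real Sᶜ := by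
    have := measureReal_union_le (μ := ProbabilityTheory.cond μ A) S Sᶜ
    rwa [Set.union_compl_self, probReal_univ] at this
  linarith

/-- Sampling without replacement from a population of Lipschitz increments that is determined by
the past. -/
theorem measure_lt_norm_increment_error_le {Ω : Type*} {N : ℕ} {𝓖 : MeasurableSpace Ω}
    [mΩ : MeasurableSpace Ω] {μ : Measure Ω} (h𝓖 : 𝓖 ≤ mΩ) {R : Set Ω} {ξ : Ω → Finset (Fin N)}
    (hξ : UniformWithoutReplacement μ 𝓖 R ξ) {A : Set Ω} (hA : MeasurableSet[𝓖] A)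
    {U W : Type*} [NormedAddCommGroup U] [MeasurableSpace U] [BorelSpace U]
    [SecondCountableTopology U] [NormedAddCommGroup W] [NormedSpace ℝ W]
    {h : Fin N → U → W} {L : ℝ≥0} (hL : ∀ i, LipschitzWith L (h i)) {K Λ ζ : ℝ} (hK : 0 ≤ K)
    (hsub : ∀ (y z : U) (r : ℝ), (∀ i, ‖h i y - h i z‖ ≤ r) →
      SubGaussianDifferences (fun i => h i y - h i z) r K)
    (hΛ : 0 < Λ) (hζ : 2 * K * Real.exp (-Λ) ≤ ζ) {x y : Ω → U} (hx : Measurable[𝓖] x)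
    (hy : Measurable[𝓖] y) {t : Ω → ℝ} (ht : Measurable[𝓖] t) (ht0 : ∀ ω, 0 < t ω)
    (hsize : ∀ᵐ ω ∂μ, ω ∈ A → ω ∈ R ∧ ((L : ℝ) * ‖x ω - y ω‖ ≠ 0 →
      (1 / (N : ℝ) + t ω ^ 2 / (64 * (L : ℝ) ^ 2 * ‖x ω - y ω‖ ^ 2 * Λ))⁻¹ ≤ ((ξ ω).card : ℝ))) :
    μ (A ∩ {ω | t ω < ‖(1 / ((ξ ω).card : ℝ)) • ∑ i ∈ ξ ω, (h i (x ω) - h i (y ω)) -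
        (1 / (N : ℝ)) • ∑ i, (h i (x ω) - h i (y ω))‖}) ≤ ENNReal.ofReal ζ * μ A := by
  have hζ0 : 0 ≤ ζ := le_trans (by positivity) hζ
  refine hξ.measure_inter_bad_le h𝓖 hA (bad := fun T =>
    {ω | t ω < ‖(1 / (T.card : ℝ)) • ∑ i ∈ T, (h i (x ω) - h i (y ω)) -
        (1 / (N : ℝ)) • ∑ i, (h i (x ω) - h i (y ω))‖}) (fun T => ?_) ?_
  · refine measurableSet_lt ht ?_
    have hc : Continuous fun p : U × U =>
        ‖(1 / (T.card : ℝ)) • ∑ i ∈ T, (h i p.1 - h i p.2) -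
          (1 / (N : ℝ)) • ∑ i, (h i p.1 - h i p.2)‖ := by
      have := fun i => (hL i).continuous
      fun_prop
    exact hc.measurable.comp (hx.prodMk hy)
  · filter_upwards [hsize] with ω hω hωA
    obtain ⟨hR, hs⟩ := hω hωA
    refine ⟨hR, ?_⟩
    have hpos : 0 < (ξ ω).card := Finset.card_pos.2 (hξ.nonempty ω hR)
    have hle : (ξ ω).card ≤ N := by simpa using (ξ ω).card_le_univ
    set n := (ξ ω).card
    have hincr : ∀ i, ‖h i (x ω) - h i (y ω)‖ ≤ L * ‖x ω - y ω‖ := fun i =>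
      (hL i).norm_sub_le _ _
    have key : (((Finset.powersetCard n Finset.univ).filter fun T : Finset (Fin N) =>
        t ω < ‖(1 / (n : ℝ)) • ∑ i ∈ T, (h i (x ω) - h i (y ω)) -
          (1 / (N : ℝ)) • ∑ i, (h i (x ω) - h i (y ω))‖).card : ℝ) ≤ N.choose n * ζ := by
      -- In the degenerate case all increments vanish, every sample is exact, and no size condition
      -- is needed.
      by_cases h0 : (L : ℝ) * ‖x ω - y ω‖ = 0
      · have hz : ∀ i, h i (x ω) - h i (y ω) = 0 := fun i =>
          norm_le_zero_iff.1 ((hincr i).trans h0.le)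
        simp only [hz, Finset.sum_const_zero, smul_zero, sub_zero, norm_zero,
          (ht0 ω).not_gt, Finset.filter_false, Finset.card_empty, Nat.cast_zero]
        positivity
      · refine (card_lt_norm_sampleMean_sub_mean_le hpos hle (hsub _ _ _ hincr)
          (lt_of_le_of_ne (by positivity) (Ne.symm h0)) hK (ht0 ω) hΛ ?_).trans ?_
        · rw [mul_pow, ← mul_assoc]
          exact hs h0
        · gcongr
    rw [← ENNReal.ofReal_natCast, ← ENNReal.ofReal_natCast (N.choose n), ← ENNReal.ofReal_mul hζ0]
    refine ENNReal.ofReal_le_ofReal ?_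
    rw [mul_comm ζ]
    refine le_trans (le_of_eq ?_) key
    refine congrArg (fun s : Finset (Finset (Fin N)) => (s.card : ℝ)) (Finset.ext fun T => ?_)
    simp only [Finset.mem_filter]
    refine and_congr_right fun hT => ?_
    rw [(Finset.mem_powersetCard.1 hT).2]

/-! ### The derivatives of the objective -/

section Derivatives

variable {d N : ℕ}

lemma gradient_objective {f : Fin N → E d → ℝ} (hf : ∀ i, Differentiable ℝ (f i)) (x : E d) :
    ∇ (objective f) x = (1 / (N : ℝ)) • ∑ i, ∇ (f i) x := by
  have h : fderiv ℝ (objective f) x = (1 / (N : ℝ)) • ∑ i, fderiv ℝ (f i) x :=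
    ((HasFDerivAt.fun_sum fun i _ => (hf i x).hasFDerivAt).const_mul (1 / (N : ℝ))).fderiv
  simp only [gradient, h, map_smul, map_sum]

lemma hessian_objective {f : Fin N → E d → ℝ} (hf : ∀ i, Differentiable ℝ (f i))
    (hf' : ∀ i, Differentiable ℝ (∇ (f i))) (x : E d) :
    hessian (objective f) x = (1 / (N : ℝ)) • ∑ i, hessian (f i) x := by
  have h : ∇ (objective f) = fun x => (1 / (N : ℝ)) • ∑ i, ∇ (f i) x :=
    funext fun x => gradient_objective hf x
  rw [hessian, h]
  exact ((HasFDerivAt.fun_sum fun i _ => (hf' i x).hasFDerivAt).const_smul (1 / (N : ℝ))).fderiv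

lemma isSelfAdjoint_hessian {g : E d → ℝ} (hg : Differentiable ℝ g)
    (hg' : Differentiable ℝ (∇ g)) (x : E d) : IsSelfAdjoint (hessian g x) := by
  have h1 : ∀ y, HasFDerivAt g (InnerProductSpace.toDual ℝ (E d) (∇ g y)) y := fun y => by
    rw [gradient, LinearIsometryEquiv.apply_symm_apply]
    exact (hg y).hasFDerivAt
  -- The Riesz map is conjugate-linear in general; over `ℝ` it is repackaged as a linear map so that
  -- the chain rule applies and symmetry of second derivatives can be used.
  let T : E d →L[ℝ] E d →L[ℝ] ℝ := LinearMap.toContinuousLinearMap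
    { toFun := fun v => InnerProductSpace.toDual ℝ (E d) v
      map_add' := fun v w => map_add _ v w
      map_smul' := fun c v => by simp }
  have h2 : HasFDerivAt (fun y => InnerProductSpace.toDual ℝ (E d) (∇ g y))
      (T.comp (hessian g x)) x :=
    T.hasFDerivAt.comp x (hg' x).hasFDerivAt
  rw [ContinuousLinearMap.isSelfAdjoint_iff_isSymmetric]
  intro u v
  have h3 := second_derivative_symmetric h1 h2 u v
  have h4 : ⟪hessian g x u, v⟫ = ⟪hessian g x v, u⟫ := h3
  exact h4.trans (real_inner_comm _ _)

variable {Ω : Type*} {m k : ℕ}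

lemma gradEstimate_sub_gradient {f : Fin N → E d → ℝ} (hf : ∀ i, Differentiable ℝ (f i))
    (hk : k % m ≠ 0) (x : ℕ → Ω → E d) (ξ : ℕ → Ω → Finset (Fin N)) (ω : Ω) :
    gradEstimate f m x ξ k ω - ∇ (objective f) (x k ω) =
      (1 / ((ξ k ω).card : ℝ)) •
        ∑ i ∈ ξ k ω, (∇ (f i) (x k ω) - ∇ (f i) (snapshot m x k ω)) -
      (1 / (N : ℝ)) • ∑ i, (∇ (f i) (x k ω) - ∇ (f i) (snapshot m x k ω)) := by
  rw [gradEstimate, if_neg hk, gradient_objective hf, gradient_objective hf,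
    Finset.sum_sub_distrib (s := Finset.univ), smul_sub (1 / (N : ℝ))]
  abel

lemma hessEstimate_sub_hessian {f : Fin N → E d → ℝ} (hf : ∀ i, Differentiable ℝ (f i))
    (hf' : ∀ i, Differentiable ℝ (∇ (f i)))
    (hk : k % m ≠ 0) (x : ℕ → Ω → E d) (ξ : ℕ → Ω → Finset (Fin N)) (ω : Ω) :
    hessEstimate f m x ξ k ω - hessian (objective f) (x k ω) =
      (1 / ((ξ k ω).card : ℝ)) •
        ∑ i ∈ ξ k ω, (hessian (f i) (x k ω) - hessian (f i) (snapshot m x k ω)) -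
      (1 / (N : ℝ)) • ∑ i, (hessian (f i) (x k ω) - hessian (f i) (snapshot m x k ω)) := by
  rw [hessEstimate, if_neg hk, hessian_objective hf hf', hessian_objective hf hf',
    Finset.sum_sub_distrib (s := Finset.univ), smul_sub (1 / (N : ℝ))]
  abel

end Derivatives

/-! ### Accuracy of the gradient and Hessian estimates. -/

lemma max_sq {a b : ℝ} (ha : 0 ≤ a) (hb : 0 ≤ b) : max a b ^ 2 = max (a ^ 2) (b ^ 2) := by
  rcases le_total a b with h | h
  · rw [max_eq_right h, max_eq_right (pow_le_pow_left₀ ha h 2)]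
  · rw [max_eq_left h, max_eq_left (pow_le_pow_left₀ hb h 2)]

lemma IsRun.measurable_snapshot {Ω : Type*} [mΩ : MeasurableSpace Ω] {d N : ℕ}
    {f : Fin N → E d → ℝ} {m : ℕ} {M ε₁ : ℝ} {x₀ : E d} {μ : Measure Ω} {ℱ : Filtration ℕ mΩ}
    {x s : ℕ → Ω → E d} {ξg ξH : ℕ → Ω → Finset (Fin N)}
    (hrun : IsRun f m M ε₁ x₀ μ ℱ x s ξg ξH) (k : ℕ) : Measurable[ℱ k] (snapshot m x k) :=
  (hrun.measurable_x (k / m * m)).mono (ℱ.mono (Nat.div_mul_le_self k m)) le_rfl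

/-- The gradient estimate is accurate with high conditional probability. -/
theorem one_sub_le_cond_gradEstimate {Ω : Type*} [mΩ : MeasurableSpace Ω] {d N : ℕ}
    {f : Fin N → E d → ℝ} {L₀ L₁ L₂ : ℝ≥0} (hf : ObjectiveAssumption f L₀ L₁ L₂)
    {m : ℕ} {M ε₁ : ℝ} (hε₁ : 0 < ε₁) {x₀ : E d}
    {μ : Measure Ω} [IsProbabilityMeasure μ] {ℱ : Filtration ℕ mΩ}
    {x s : ℕ → Ω → E d} {ξg ξH : ℕ → Ω → Finset (Fin N)}
    (hrun : IsRun f m M ε₁ x₀ μ ℱ x s ξg ξH)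
    {β ζ : ℝ} (hβ : 0 < β) (hζ : 0 < ζ) (hζ1 : ζ < 1) (k : ℕ) {A : Set Ω}
    (hA : MeasurableSet[ℱ k] A) (hμA : μ A ≠ 0)
    (hsize : ∀ᵐ ω ∂μ, ω ∈ A → Running ε₁ s k ω ∧
        ((L₁ : ℝ) * ‖x k ω - snapshot m x k ω‖ ≠ 0 →
          (1 / (N : ℝ) + β ^ 2 * max (‖s k ω‖ ^ 4) (ε₁ ^ 4) /
            (64 * (L₁ : ℝ) ^ 2 * ‖x k ω - snapshot m x k ω‖ ^ 2 *
              Real.log (2 * ((d : ℝ) + 1) / ζ)))⁻¹ ≤ ((ξg k ω).card : ℝ))) :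
    1 - ζ ≤ (ProbabilityTheory.cond μ A).real
        {ω | ‖gradEstimate f m x ξg k ω - ∇ (objective f) (x k ω)‖
          ≤ β * max (‖s k ω‖ ^ 2) (ε₁ ^ 2)} := by
  refine one_sub_le_cond_real (ℱ.le k _ hA) hμA hζ.le ?_
  have hpos : ∀ ω, 0 < β * max (‖s k ω‖ ^ 2) (ε₁ ^ 2) := fun ω =>
    mul_pos hβ (lt_max_of_lt_right (by positivity))
  by_cases hk : k % m = 0
  · have : A ∩ {ω | ‖gradEstimate f m x ξg k ω - ∇ (objective f) (x k ω)‖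
          ≤ β * max (‖s k ω‖ ^ 2) (ε₁ ^ 2)}ᶜ = ∅ := by
      refine Set.eq_empty_of_forall_notMem fun ω hω => hω.2 ?_
      rw [Set.mem_ofPred_eq, gradEstimate, if_pos hk, sub_self, norm_zero]
      exact (hpos ω).le
    rw [this, measure_empty]
    exact zero_le
  have hlog : 1 < 2 * ((d : ℝ) + 1) / ζ := by
    rw [one_lt_div hζ]
    linarith [(Nat.cast_nonneg d : (0 : ℝ) ≤ d)]
  -- The vector bound is dimension-free (`K = 1`), so the failure probability is even `ζ / (d + 1)`.
  have hprob : 2 * 1 * Real.exp (-Real.log (2 * ((d : ℝ) + 1) / ζ)) ≤ ζ := by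
    rw [Real.exp_neg, Real.exp_log (by linarith), inv_div, mul_one, ← mul_div_assoc,
      mul_div_mul_left _ _ two_ne_zero]
    exact div_le_self hζ.le (by linarith [(Nat.cast_nonneg d : (0 : ℝ) ≤ d)])
  have ht : Measurable[ℱ k] fun ω => β * max (‖s k ω‖ ^ 2) (ε₁ ^ 2) :=
    (show Continuous fun v : E d => β * max (‖v‖ ^ 2) (ε₁ ^ 2) by fun_prop).measurable.comp
      (hrun.measurable_s k)
  refine le_trans (measure_mono ?_) (measure_lt_norm_increment_error_le (ℱ.le k)
    (hrun.sample_grad k hk) hA hf.lipschitz_gradient zero_le_one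
    (fun _ _ _ hr => subGaussianDifferences_of_inner hr) (Real.log_pos hlog) hprob
    (hrun.measurable_x k) (hrun.measurable_snapshot k)
    (t := fun ω => β * max (‖s k ω‖ ^ 2) (ε₁ ^ 2))
    ht hpos ?_)
  · refine Set.inter_subset_inter_right _ fun ω hω => ?_
    have : ¬ ‖gradEstimate f m x ξg k ω - ∇ (objective f) (x k ω)‖ ≤
      β * max (‖s k ω‖ ^ 2) (ε₁ ^ 2) := hω
    rwa [not_le, gradEstimate_sub_gradient hf.differentiable hk] at this
  · filter_upwards [hsize] with ω hω hωA
    refine ⟨(hω hωA).1, fun h0 => ?_⟩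
    have := (hω hωA).2 h0
    rwa [mul_pow, max_sq (by positivity) (by positivity), ← pow_mul, ← pow_mul]

/-- The Hessian estimate is accurate with high conditional probability. -/
theorem one_sub_le_cond_hessEstimate {Ω : Type*} [mΩ : MeasurableSpace Ω] {d N : ℕ}
    {f : Fin N → E d → ℝ} {L₀ L₁ L₂ : ℝ≥0} (hf : ObjectiveAssumption f L₀ L₁ L₂)
    {m : ℕ} {M ε₁ : ℝ} (hε₁ : 0 < ε₁) {x₀ : E d}
    {μ : Measure Ω} [IsProbabilityMeasure μ] {ℱ : Filtration ℕ mΩ}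
    {x s : ℕ → Ω → E d} {ξg ξH : ℕ → Ω → Finset (Fin N)}
    (hrun : IsRun f m M ε₁ x₀ μ ℱ x s ξg ξH)
    {α ζ : ℝ} (hα : 0 < α) (hζ : 0 < ζ) (hζ1 : ζ < 1) (k : ℕ) {A : Set Ω}
    (hA : MeasurableSet[ℱ k] A) (hμA : μ A ≠ 0)
    (hsize : ∀ᵐ ω ∂μ, ω ∈ A → Running ε₁ s k ω ∧
        ((L₂ : ℝ) * ‖x k ω - snapshot m x k ω‖ ≠ 0 →
          (1 / (N : ℝ) + α ^ 2 * max (‖s k ω‖ ^ 2) (ε₁ ^ 2) /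
            (64 * (L₂ : ℝ) ^ 2 * ‖x k ω - snapshot m x k ω‖ ^ 2 *
              Real.log (4 * (d : ℝ) / ζ)))⁻¹ ≤ ((ξH k ω).card : ℝ))) :
    1 - ζ ≤ (ProbabilityTheory.cond μ A).real
        {ω | ‖hessEstimate f m x ξH k ω - hessian (objective f) (x k ω)‖
          ≤ α * max ‖s k ω‖ ε₁} := by
  refine one_sub_le_cond_real (ℱ.le k _ hA) hμA hζ.le ?_
  have hpos : ∀ ω, 0 < α * max ‖s k ω‖ ε₁ := fun ω => mul_pos hα (lt_max_of_lt_right hε₁)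
  -- For `d = 0` the operator space is trivial and the error vanishes; the trace argument needs a
  -- nontrivial space, and `log (4 d / ζ)` would be `log 0 = 0`.
  by_cases hk : k % m = 0 ∨ d = 0
  · have : A ∩ {ω | ‖hessEstimate f m x ξH k ω - hessian (objective f) (x k ω)‖
          ≤ α * max ‖s k ω‖ ε₁}ᶜ = ∅ := by
      refine Set.eq_empty_of_forall_notMem fun ω hω => hω.2 ?_
      have h0 : hessEstimate f m x ξH k ω - hessian (objective f) (x k ω) = 0 := by
        rcases hk with hk | rfl
        · rw [hessEstimate, if_pos hk, sub_self]
        · exact Subsingleton.elim _ _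
      rw [Set.mem_ofPred_eq, h0, norm_zero]
      exact (hpos ω).le
    rw [this, measure_empty]
    exact zero_le
  obtain ⟨hk, hd⟩ := not_or.1 hk
  have : NeZero d := ⟨hd⟩
  have hd1 : (1 : ℝ) ≤ d := by exact_mod_cast Nat.one_le_iff_ne_zero.2 hd
  have hlog : 1 < 4 * (d : ℝ) / ζ := by
    rw [one_lt_div hζ]
    linarith
  -- With `K = d` the left side equals `ζ / 2`.
  have hprob : 2 * (Module.finrank ℝ (E d) : ℝ) * Real.exp (-Real.log (4 * (d : ℝ) / ζ)) ≤ ζ := by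
    rw [Real.exp_neg, Real.exp_log (by linarith), inv_div, finrank_euclideanSpace_fin,
      ← mul_div_assoc, div_le_iff₀ (by linarith)]
    nlinarith
  have ht : Measurable[ℱ k] fun ω => α * max ‖s k ω‖ ε₁ :=
    (show Continuous fun v : E d => α * max ‖v‖ ε₁ by fun_prop).measurable.comp
      (hrun.measurable_s k)
  refine le_trans (measure_mono ?_) (measure_lt_norm_increment_error_le (ℱ.le k)
    (hrun.sample_hess k hk) hA hf.lipschitz_hessian (Nat.cast_nonneg _)
    (fun y z _ hr => subGaussianDifferences_of_isSelfAdjoint (fun i =>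
      (isSelfAdjoint_hessian (hf.differentiable i) (hf.differentiable_gradient i) y).sub
        (isSelfAdjoint_hessian (hf.differentiable i) (hf.differentiable_gradient i) z)) hr)
    (Real.log_pos hlog) hprob (hrun.measurable_x k) (hrun.measurable_snapshot k)
    (t := fun ω => α * max ‖s k ω‖ ε₁)
    ht hpos ?_)
  · refine Set.inter_subset_inter_right _ fun ω hω => ?_
    have : ¬ ‖hessEstimate f m x ξH k ω - hessian (objective f) (x k ω)‖ ≤
      α * max ‖s k ω‖ ε₁ := hω
    rwa [not_le, hessEstimate_sub_hessian hf.differentiable hf.differentiable_gradient hk] at this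
  · filter_upwards [hsize] with ω hω hωA
    refine ⟨(hω hωA).1, fun h0 => ?_⟩
    have := (hω hωA).2 h0
    rwa [mul_pow, max_sq (by positivity) hε₁.le]

end SVRC

/-- Per-iteration sample complexity of SVRC under sampling without replacement. The event `A` is any
event known before the minibatches of iteration `k` are drawn, on which iteration `k` is carried
out with minibatches of the required size; for `A = {ω | Running ε₁ s k ω}` the bound is the one
given only that iteration `k` is carried out. Where `L ‖x_k - x̃‖ = 0`, the threshold is read as `0`,
its limit (the quotient in it is infinite). -/
theorem theorem5 {Ω : Type*} [mΩ : MeasurableSpace Ω] {d N : ℕ} (hN : 0 < N)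
    (f : Fin N → SVRC.E d → ℝ) (L₀ L₁ L₂ : ℝ≥0) (hf : SVRC.ObjectiveAssumption f L₀ L₁ L₂)
    (m : ℕ) (hm : 0 < m) (M ε₁ : ℝ) (hM : 0 < M) (hε₁ : 0 < ε₁) (x₀ : SVRC.E d)
    (μ : Measure Ω) [IsProbabilityMeasure μ] (ℱ : Filtration ℕ mΩ)
    (x s : ℕ → Ω → SVRC.E d) (ξg ξH : ℕ → Ω → Finset (Fin N))
    (hrun : SVRC.IsRun f m M ε₁ x₀ μ ℱ x s ξg ξH)
    (α β ζ : ℝ) (hα : 0 < α) (hβ : 0 < β) (hζ : 0 < ζ) (hζ1 : ζ < 1) :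
    (∀ (k : ℕ) (A : Set Ω), MeasurableSet[ℱ k] A → μ A ≠ 0 →
      (∀ᵐ ω ∂μ, ω ∈ A → SVRC.Running ε₁ s k ω ∧
        ((L₁ : ℝ) * ‖x k ω - SVRC.snapshot m x k ω‖ ≠ 0 →
          (1 / (N : ℝ) + β ^ 2 * max (‖s k ω‖ ^ 4) (ε₁ ^ 4) /
            (64 * (L₁ : ℝ) ^ 2 * ‖x k ω - SVRC.snapshot m x k ω‖ ^ 2 *
              Real.log (2 * ((d : ℝ) + 1) / ζ)))⁻¹ ≤ ((ξg k ω).card : ℝ))) →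
      1 - ζ ≤ (ProbabilityTheory.cond μ A).real
        {ω | ‖SVRC.gradEstimate f m x ξg k ω - ∇ (SVRC.objective f) (x k ω)‖
          ≤ β * max (‖s k ω‖ ^ 2) (ε₁ ^ 2)}) ∧
    (∀ (k : ℕ) (A : Set Ω), MeasurableSet[ℱ k] A → μ A ≠ 0 →
      (∀ᵐ ω ∂μ, ω ∈ A → SVRC.Running ε₁ s k ω ∧
        ((L₂ : ℝ) * ‖x k ω - SVRC.snapshot m x k ω‖ ≠ 0 →
          (1 / (N : ℝ) + α ^ 2 * max (‖s k ω‖ ^ 2) (ε₁ ^ 2) /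
            (64 * (L₂ : ℝ) ^ 2 * ‖x k ω - SVRC.snapshot m x k ω‖ ^ 2 *
              Real.log (4 * (d : ℝ) / ζ)))⁻¹ ≤ ((ξH k ω).card : ℝ))) →
      1 - ζ ≤ (ProbabilityTheory.cond μ A).real
        {ω | ‖SVRC.hessEstimate f m x ξH k ω - SVRC.hessian (SVRC.objective f) (x k ω)‖
          ≤ α * max ‖s k ω‖ ε₁}) :=
  ⟨fun k _ hA hμA hsize =>
      SVRC.one_sub_le_cond_gradEstimate hf hε₁ hrun hβ hζ hζ1 k hA hμA hsize,
    fun k _ hA hμA hsize =>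
      SVRC.one_sub_le_cond_hessEstimate hf hε₁ hrun hα hζ hζ1 k hA hμA hsize⟩
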